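/- **Setting.** Let $\Omega\subset\mathbb R^n$ be a bounded open set and let $\mathbb S^n$ be the space of real symmetric $n\times n$ matrices. For an open set $U$, $C^k(\bar U)$ denotes the functions that are $C^k$ in $U$ and extend continuously to $\bar U$ together with all derivatives of order $\le k$. Let $\Gamma\subset\mathbb S^n$ be an open convex cone with vertex $0$ containing all positive definite matrices, and let $F\in C^2(\Gamma)$ satisfy, for some $a_0\in[-\infty,\infty)$: (F1) $F_r=(F_{r_{ij}})$ is positive definite in $\Gamma$; (F2) $F$ is concave in $\Gamma$; (F3) $F(\Gamma)=(a_0,\infty)$ and $\limsup_{r\to r_0,\,r\in\Gamma}F(r)\le a_0$ for every $r_0\in\partial\Gamma$. Let $F$ be orthogonally invariant: $\Gamma$ is closed under $r\mapsto QrQ^{T}$ for orthogonal $Q$, and $F(r)$ is a symmetric function of the eigenvalues of $r$. Assume also that for every $a>a_0$ there are constants $C,R$ with $$|r\cdot F_r|\le C\,(\operatorname{trace}F_r+|F(r)|)\qquad\text{for all } r\in\Gamma \text{ with } F(r)>a,\ |r|\ge R .$$ Let $A=(A_{ij})\in C^2(\bar\Omega\times\mathbb R\times\mathbb R^n;\mathbb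 S^n)$ be regular, i.e. $\sum A_{ij}^{kl}\,\xi_i\xi_j\eta_k\eta_l\ge0$ whenever $\xi\cdot\eta=0$, where $A_{ij}^{kl}=D^2_{p_kp_l}A_{ij}$, and let $B\in C^2(\bar\Omega\times\mathbb R\times\mathbb R^n)$ be convex in $p$ with $B>a_0$ on $\bar\Omega\times\mathbb R\times\mathbb R^n$. Let $\gamma\in C^2(\bar\Omega;\mathbb R^n)$ be a unit vector field, $|\gamma|=1$ in $\Omega$ (for instance an extension of the unit normal field of $\partial\Omega$), and let $\underline u\in C^2(\bar\Omega)$. **Lemma.** For all $M\in\mathbb R$ and $\delta>0$ there are constants $K,\epsilon_2>0$, depending only on $n,F,\Gamma,\Omega,A,B,\gamma,\underline u,M$ and $\delta$, such that the following holds. Let $u\in C^3(\Omega)\cap C^2(\bar\Omega)$ with $|u|_{1;\Omega}=\sup_\Omega|u|+\sup_\Omega|Du|\le M$ be an admissible solution of $$F(M[u])=B(\cdot,u,Du),\qquad M[u]=D^2u-A(\cdot,u,Du)\in\Gamma\quad\text{in }\Omega,$$ and let $\underline u$ be an admissible strict subsolution with margin $\delta$, i.e. $$M_u[\underline u]:=D^2\underline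 u-A(\cdot,u,D\underline u)\in\Gamma,\qquad F(M_u[\underline u])\ge B(\cdot,u,D\underline u)+\delta\quad\text{in }\Omega .$$ Then $$\mathcal L\Big[e^{K(\underline u-u)}+\frac{\epsilon_2}{2}|\delta u|^2\Big]\ \ge\ \epsilon_2\,(1+\mathscr T^*)\qquad\text{in }\Omega .$$ Here $\delta u=Du-(D_\gamma u)\gamma$ is the tangential gradient and $$\mathcal L=F^{ij}D_{ij}-\big(F^{ij}D_{p_k}A_{ij}+D_{p_k}B\big)D_k$$ is the linearized operator, with $(F^{ij})=F_r(M[u])$ and the derivatives of $A,B$ taken at $(x,u,Du)$. At each point $x\in\Omega$, $$\mathscr T^*=\sum_{i=1}^nF^{ii}(1+|w_{ii}|),$$ where the entries of $F_r(M[u])$ and of $w=M[u]$ are taken in any orthonormal coordinates in which $w(x)$ is diagonal. -/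

import Mathlib

open Filter Topology
open scoped Gradient Matrix

noncomputable section

namespace AugHess

/-- Euclidean space `ℝⁿ`. -/
abbrev E (n : ℕ) := EuclideanSpace ℝ (Fin n)

/-- The linear space `𝕊ⁿ` of real symmetric `n × n` arrays `r = (r_{ij})`, as a subspace of
`Fin n → Fin n → ℝ` (so that `‖r‖ = max |r_{ij}|`). -/
def symSubmodule (n : ℕ) : Submodule ℝ (Fin n → Fin n → ℝ) where
  carrier := {r | ∀ i j, r i j = r j i}
  add_mem' := fun ha hb i j => congrArg₂ (· + ·) (ha i j) (hb i j)
  zero_mem' := fun _ _ => rfl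
  smul_mem' := fun c _ ha i j => congrArg (c * ·) (ha i j)

/-- The space `𝕊ⁿ`. -/
abbrev SymMat (n : ℕ) := ↥(symSubmodule n)

/-- A symmetric array regarded as a matrix. -/
def mat {n : ℕ} (r : SymMat n) : Matrix (Fin n) (Fin n) ℝ := Matrix.of (r : Fin n → Fin n → ℝ)

/-- The symmetric part `(r + rᵀ) / 2` (which is `r` itself if `r` is symmetric). -/
def symPart {n : ℕ} (r : Fin n → Fin n → ℝ) : SymMat n :=
  ⟨fun i j => (r i j + r j i) / 2, fun i j => by simp only [add_comm]⟩

/-! ### Derivatives -/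

/-- The `i`-th partial derivative `D_i f`. -/
def pd {n : ℕ} (i : Fin n) (f : E n → ℝ) (x : E n) : ℝ :=
  fderiv ℝ f x (EuclideanSpace.single i 1)

/-- The Hessian matrix `D²f`; for `f` of class `C²` the matrix `(D_i D_j f)` is already
symmetric, and taking the symmetric part only serves to land in `𝕊ⁿ`. -/
def hess {n : ℕ} (f : E n → ℝ) (x : E n) : SymMat n :=
  symPart fun i j => pd i (pd j f) x

/-- `f ∈ C^k(Ū)` for an open set `U`: `f` is `C^k` in `U`, and `f` and all its derivatives of
order at most `k` extend continuously to the closure of `U` (`f` by its own values there). -/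
def CkClosure {X Y : Type*} [NormedAddCommGroup X] [NormedSpace ℝ X]
    [NormedAddCommGroup Y] [NormedSpace ℝ Y] (k : ℕ) (U : Set X) (f : X → Y) : Prop :=
  ContDiffOn ℝ k f U ∧ ContinuousOn f (closure U) ∧
    ∀ j ≤ k, ∃ g : X → ContinuousMultilinearMap ℝ (fun _ : Fin j => X) Y,
      ContinuousOn g (closure U) ∧ ∀ x ∈ U, g x = iteratedFDeriv ℝ j f x

/-- `|u|_{1;Ω} = sup_Ω |u| + sup_Ω |Du| ≤ M`. -/
def C1NormLE {n : ℕ} (Ω : Set (E n)) (u : E n → ℝ) (M : ℝ) : Prop :=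
  ∀ x ∈ Ω, ∀ y ∈ Ω, |u x| + ‖∇ u y‖ ≤ M

/-! ### The function `F` on the cone `Γ` -/

/-- The matrix `F_r = (F^{ij})`, `F^{ij} = ∂F/∂r_{ij}`, at the symmetric matrix `r`: the symmetric
matrix with `dF_r(η) = ∑ F^{ij} η_{ij}` for all symmetric `η`. -/
def Fr {n : ℕ} (F : SymMat n → ℝ) (r : SymMat n) : Matrix (Fin n) (Fin n) ℝ :=
  Matrix.of fun i j => fderiv ℝ F r (symPart (Matrix.single i j (1 : ℝ)))

/-- The standing assumptions on the cone `Γ` and on `F`, including F1, F2, F3. The value of `F`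
outside `Γ` is irrelevant; `a₀` is a real number or `-∞`. -/
structure BasicConditions {n : ℕ} (Γ : Set (SymMat n)) (F : SymMat n → ℝ) (a₀ : EReal) :
    Prop where
  isOpen : IsOpen Γ
  convex : Convex ℝ Γ
  cone : ∀ r ∈ Γ, ∀ t : ℝ, 0 < t → t • r ∈ Γ
  posCone : ∀ r : SymMat n, (mat r).PosDef → r ∈ Γ
  contDiff : ContDiffOn ℝ 2 F Γ
  F1 : ∀ r ∈ Γ, (Fr F r).PosDef
  F2 : ConcaveOn ℝ Γ F
  F3_range : F '' Γ = {t : ℝ | a₀ < (t : EReal)}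
  F3_limsup : ∀ r₀ ∈ frontier Γ, limsup (fun r => (F r : EReal)) (𝓝[Γ] r₀) ≤ a₀

/-- Orthogonal invariance: `Γ` is closed under orthogonal transformations and `F` is given in `Γ`
as a symmetric function `f` of the eigenvalues. -/
def OrthInvariant {n : ℕ} (Γ : Set (SymMat n)) (F : SymMat n → ℝ) : Prop :=
  (∀ Q ∈ Matrix.orthogonalGroup (Fin n) ℝ, ∀ r ∈ Γ, ∀ s : SymMat n,
      mat s = Q * mat r * Qᵀ → s ∈ Γ) ∧
    ∃ f : (Fin n → ℝ) → ℝ, (∀ (σ : Equiv.Perm (Fin n)) (l : Fin n → ℝ), f (l ∘ σ) = f l) ∧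
      ∀ r ∈ Γ, ∀ Q ∈ Matrix.orthogonalGroup (Fin n) ℝ, ∀ l : Fin n → ℝ,
        mat r = Q * Matrix.diagonal l * Qᵀ → F r = f l

/-- `|r · F_r| ≤ O(1) (trace F_r + |F(r)|)` as `|r| → ∞`, uniformly for `F(r) > a`, for any
`a > a₀`. -/
def GrowthCondition {n : ℕ} (Γ : Set (SymMat n)) (F : SymMat n → ℝ) (a₀ : EReal) : Prop :=
  ∀ a : ℝ, a₀ < (a : EReal) → ∃ C R : ℝ, ∀ r ∈ Γ, a < F r → R ≤ ‖r‖ →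
    |∑ i, ∑ j, mat r i j * Fr F r i j| ≤ C * ((Fr F r).trace + |F r|)

/-! ### The functions `A` and `B` -/

/-- `A_{ij}^k = D_{p_k} A_{ij}`. -/
def Ap {n : ℕ} (A : E n → ℝ → E n → SymMat n) (i j k : Fin n) (x : E n) (z : ℝ) (p : E n) : ℝ :=
  pd k (fun q => mat (A x z q) i j) p

/-- `A_{ij}^{kl} = D²_{p_k p_l} A_{ij}`. -/
def App {n : ℕ} (A : E n → ℝ → E n → SymMat n) (i j k l : Fin n) (x : E n) (z : ℝ) (p : E n) :
    ℝ :=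
  pd k (fun q => Ap A i j l x z q) p

/-- `A` is regular: `∑ A_{ij}^{kl} ξ_i ξ_j η_k η_l ≥ 0` whenever `ξ · η = 0`. For `A` of class `C²`
up to the boundary, the condition over `Ω` and the one over its closure are the same. -/
def Regular {n : ℕ} (Ω : Set (E n)) (A : E n → ℝ → E n → SymMat n) : Prop :=
  ∀ x ∈ Ω, ∀ (z : ℝ) (p ξ η : E n), inner ℝ ξ η = 0 →
    0 ≤ ∑ i, ∑ j, ∑ k, ∑ l, App A i j k l x z p * ξ i * ξ j * η k * η l

/-! ### The augmented Hessian, the equation, and the linearized operator -/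

/-- `M_u[v] = D²v - A(·, u, Dv)`. -/
def augHessWrt {n : ℕ} (A : E n → ℝ → E n → SymMat n) (u v : E n → ℝ) (x : E n) : SymMat n :=
  hess v x - A x (u x) (∇ v x)

/-- `M[u] = D²u - A(·, u, Du)`; its entries are the `w_{ij}`. -/
def augHess {n : ℕ} (A : E n → ℝ → E n → SymMat n) (u : E n → ℝ) (x : E n) : SymMat n :=
  augHessWrt A u u x

/-- `u` is an admissible solution of `F(M[u]) = B(·, u, Du)` in `Ω`. -/
def AdmissibleSolution {n : ℕ} (Ω : Set (E n)) (Γ : Set (SymMat n)) (F : SymMat n → ℝ)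
    (A : E n → ℝ → E n → SymMat n) (B : E n → ℝ → E n → ℝ) (u : E n → ℝ) : Prop :=
  ∀ x ∈ Ω, augHess A u x ∈ Γ ∧ F (augHess A u x) = B x (u x) (∇ u x)

/-- `v` is admissible with respect to `u` in `Ω` and is a strict subsolution with margin `δ`:
`F(M_u[v]) ≥ B(·, u, Dv) + δ` in `Ω`. -/
def StrictSubsolution {n : ℕ} (Ω : Set (E n)) (Γ : Set (SymMat n)) (F : SymMat n → ℝ)
    (A : E n → ℝ → E n → SymMat n) (B : E n → ℝ → E n → ℝ) (u v : E n → ℝ) (δ : ℝ) : Prop :=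
  ∀ x ∈ Ω, augHessWrt A u v x ∈ Γ ∧ B x (u x) (∇ v x) + δ ≤ F (augHessWrt A u v x)

/-- The linearized operator at `u` applied to `v`:
`ℒ v = F^{ij} D_{ij} v - (F^{ij} A_{ij}^k + D_{p_k} B) D_k v`,
with `F^{ij}` taken at `M[u]` and `A_{ij}^k`, `D_{p_k} B` at `(x, u, Du)`. -/
def linOp {n : ℕ} (F : SymMat n → ℝ) (A : E n → ℝ → E n → SymMat n) (B : E n → ℝ → E n → ℝ)
    (u v : E n → ℝ) (x : E n) : ℝ :=
  (∑ i, ∑ j, Fr F (augHess A u x) i j * pd i (pd j v) x) -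
    ∑ k, ((∑ i, ∑ j, Fr F (augHess A u x) i j * Ap A i j k x (u x) (∇ u x)) +
      pd k (fun q => B x (u x) q) (∇ u x)) * pd k v x

/-- The tangential gradient `δu = Du - (D_γ u) γ`. -/
def tangGrad {n : ℕ} (γ : E n → E n) (u : E n → ℝ) (x : E n) : E n :=
  ∇ u x - (inner ℝ (∇ u x) (γ x) : ℝ) • γ x

/-- `𝒯* = ∑ F^{ii} (1 + |w_{ii}|)`, the entries of `F_r` and of `w` being taken in the orthonormal
coordinates given by the columns of the orthogonal matrix `Q`. -/
def Tstar {n : ℕ} (F : SymMat n → ℝ) (w : SymMat n) (Q : Matrix (Fin n) (Fin n) ℝ) : ℝ :=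
  ∑ i, (Qᵀ * Fr F w * Q) i i * (1 + |(Qᵀ * mat w * Q) i i|)

end AugHess

end

/-!
At a point `x`, orthogonal invariance makes `F_r(M[u])` diagonal in every orthonormal frame `q` that
diagonalizes `w = M[u]` (`OrthInvariant.isDiag_Fr`). With eigenvalues `lam_s` of `F_r` and `mu_s`
of `w`, and `T = ∑ lam_s`, the linearized operator is `𝓛 f = ∑ lam_s D²f(q_s, q_s) - Df(β)`,
`|β| = O(1 + T)` (`linOp_eq_frameOp`), and `𝒯* = T + ∑ lam_s |mu_s|`. Let `v` denote the strict
subsolution.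

*The barrier.* By F3 and `B > a₀` the matrices `M_u[v]` stay in a fixed compact subset of `Γ`, so
that they can be lowered by some `σ I` at the cost of `δ / 2` in `F`
(`BasicConditions.exists_room`). Concavity of `F` and convexity of `B` then give
`𝓛(v - u) ≥ δ / 2 + σ T + R`, where `R` is the second-order Taylor remainder of
`p ↦ F^{ij} A_{ij}(x, u, p)` along the segment from `Du` to `Dv`. Regularity of `A` bounds it below
by `-ε T - C_ε ∑ lam_s ⟨q_s, D(v - u)⟩²` (`SpectralFrame.form_taylor_ge`), and the last sum is what
`e^{K (v - u)}` contributes with the factor `K`. Hence `𝓛 e^{K (v - u)} ≥ ε₁ (1 + T)`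
(`exists_barrier`).

*The tangential gradient.* Since `|γ| = 1`, `|δu|² = |Du|² - ⟨Du, γ⟩²`. The differentiated equation
shows `𝓛 Du = O(1 + T)` (`frameOp_fderiv_solution`), and `D_{q_s} Du = mu_s q_s + O(1)`, so that
`𝓛(|δu|² / 2) ≥ ∑ lam_s mu_s² (1 - ⟨q_s, γ⟩²) - C (1 + T + ∑ lam_s |mu_s|)`. At most one of the
factors `1 - ⟨q_s, γ⟩²` is below `1 / 2`; the corresponding term `lam_s |mu_s|` is controlled by the
others through the growth condition, which says `∑ lam_s mu_s = O(1 + T)`. Therefore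
`𝓛(|δu|² / 2) ≥ ∑ lam_s |mu_s| - C (1 + T)` (`exists_tangential_estimate`), and the combination with
`ε₂ = ε₁ / (1 + C)` has the asserted lower bound.
-/

noncomputable section

namespace AugHess

/-! ### Symmetric matrices and the spectral frame -/

/-- The bilinear form `(ξ, ζ) ↦ ∑ r_{ij} ξ_i ζ_j` of a symmetric matrix. -/
def bil {n : ℕ} (r : SymMat n) (ξ ζ : E n) : ℝ := ∑ i, ∑ j, mat r i j * ξ i * ζ j

lemma mat_symm {n : ℕ} (r : SymMat n) (i j : Fin n) : mat r i j = mat r j i := r.2 i j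

lemma mat_transpose {n : ℕ} (r : SymMat n) : (mat r)ᵀ = mat r := by
  ext i j
  exact mat_symm r j i

lemma symPart_mat {n : ℕ} (r : SymMat n) : symPart (mat r) = r := by
  ext i j
  simp only [symPart, mat_symm r j i, add_self_div_two]
  rfl

lemma mat_symPart_of_symm {n : ℕ} {X : Matrix (Fin n) (Fin n) ℝ} (h : Xᵀ = X) :
    mat (symPart X) = X := by
  ext i j
  have : X j i = X i j := congrFun (congrFun h i) j
  simp [mat, symPart, this]

/-- The symmetric part as a linear map. -/
def symPartLin (n : ℕ) : (Fin n → Fin n → ℝ) →ₗ[ℝ] SymMat n where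
  toFun X := symPart X
  map_add' X Y := by
    ext i j
    simp only [symPart, Submodule.coe_add, Pi.add_apply]
    ring
  map_smul' c X := by
    ext i j
    simp only [symPart, Submodule.coe_smul, Pi.smul_apply, smul_eq_mul, RingHom.id_apply]
    ring

lemma abs_mat_le {n : ℕ} (r : SymMat n) (i j : Fin n) : |mat r i j| ≤ ‖r‖ := by
  have h1 : ‖r.1 i‖ ≤ ‖r.1‖ := norm_le_pi_norm r.1 i
  have h2 : ‖r.1 i j‖ ≤ ‖r.1 i‖ := norm_le_pi_norm (r.1 i) j
  exact h2.trans h1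

lemma bil_symm {n : ℕ} (r : SymMat n) (ξ ζ : E n) : bil r ξ ζ = bil r ζ ξ := by
  unfold bil
  rw [Finset.sum_comm]
  refine Finset.sum_congr rfl fun i _ => Finset.sum_congr rfl fun j _ => ?_
  rw [mat_symm]
  ring

lemma bil_add_right {n : ℕ} (r : SymMat n) (ξ ζ ζ' : E n) :
    bil r ξ (ζ + ζ') = bil r ξ ζ + bil r ξ ζ' := by
  simp only [bil, PiLp.add_apply, mul_add, Finset.sum_add_distrib]

lemma bil_smul_right {n : ℕ} (r : SymMat n) (c : ℝ) (ξ ζ : E n) :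
    bil r ξ (c • ζ) = c * bil r ξ ζ := by
  simp only [bil, PiLp.smul_apply, smul_eq_mul, Finset.mul_sum]
  refine Finset.sum_congr rfl fun i _ => Finset.sum_congr rfl fun j _ => ?_
  ring

lemma bil_add_left {n : ℕ} (r : SymMat n) (ξ ξ' ζ : E n) :
    bil r (ξ + ξ') ζ = bil r ξ ζ + bil r ξ' ζ := by
  rw [bil_symm, bil_add_right, bil_symm r ζ, bil_symm r ζ]

lemma bil_smul_left {n : ℕ} (r : SymMat n) (c : ℝ) (ξ ζ : E n) :
    bil r (c • ξ) ζ = c * bil r ξ ζ := by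
  rw [bil_symm, bil_smul_right, bil_symm]

lemma bil_sub_mat {n : ℕ} (r s : SymMat n) (ξ ζ : E n) :
    bil (r - s) ξ ζ = bil r ξ ζ - bil s ξ ζ := by
  simp only [bil, ← Finset.sum_sub_distrib]
  refine Finset.sum_congr rfl fun i _ => Finset.sum_congr rfl fun j _ => ?_
  have : mat (r - s) i j = mat r i j - mat s i j := rfl
  rw [this]
  ring

lemma abs_bil_le {n : ℕ} (r : SymMat n) (ξ ζ : E n) :
    |bil r ξ ζ| ≤ (n : ℝ) ^ 2 * ‖r‖ * ‖ξ‖ * ‖ζ‖ := by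
  have hb : ∀ i j : Fin n, |mat r i j * ξ i * ζ j| ≤ ‖r‖ * ‖ξ‖ * ‖ζ‖ := fun i j => by
    rw [abs_mul, abs_mul]
    have h1 := abs_mat_le r i j
    have h2 : |ξ i| ≤ ‖ξ‖ := PiLp.norm_apply_le ξ i
    have h3 : |ζ j| ≤ ‖ζ‖ := PiLp.norm_apply_le ζ j
    gcongr
  calc |bil r ξ ζ| ≤ ∑ i : Fin n, ∑ j : Fin n, |mat r i j * ξ i * ζ j| :=
        (Finset.abs_sum_le_sum_abs _ _).trans
          (Finset.sum_le_sum fun i _ => Finset.abs_sum_le_sum_abs _ _)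
    _ ≤ ∑ _i : Fin n, ∑ _j : Fin n, ‖r‖ * ‖ξ‖ * ‖ζ‖ :=
        Finset.sum_le_sum fun i _ => Finset.sum_le_sum fun j _ => hb i j
    _ = (n : ℝ) ^ 2 * ‖r‖ * ‖ξ‖ * ‖ζ‖ := by
        simp only [Finset.sum_const, Finset.card_univ, Fintype.card_fin, nsmul_eq_mul]
        ring

/-- `∑ F^{ij} X_{ij} = dF(X)`, with `dF` extended by zero to antisymmetric matrices. -/
lemma sum_Fr_mul {n : ℕ} (F : SymMat n → ℝ) (r : SymMat n) (X : Matrix (Fin n) (Fin n) ℝ) :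
    ∑ i, ∑ j, Fr F r i j * X i j = fderiv ℝ F r (symPart X) := by
  have h : symPart X = ∑ i, ∑ j, X i j • symPart (Matrix.single i j (1 : ℝ)) := by
    let S : Matrix (Fin n) (Fin n) ℝ →ₗ[ℝ] SymMat n := symPartLin n
    change S X = ∑ i, ∑ j, X i j • S (Matrix.single i j (1 : ℝ))
    conv_lhs => rw [Matrix.matrix_eq_sum_single X]
    simp only [map_sum, ← map_smul, Matrix.smul_single, smul_eq_mul, mul_one]
  rw [h]
  simp only [map_sum, map_smul, smul_eq_mul, Fr, Matrix.of_apply, mul_comm]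

lemma sum_Fr_mul_mat {n : ℕ} (F : SymMat n → ℝ) (r η : SymMat n) :
    ∑ i, ∑ j, Fr F r i j * mat η i j = fderiv ℝ F r η := by
  rw [sum_Fr_mul, symPart_mat]

/-- Conjugation `r ↦ R r Rᵀ` on symmetric matrices. -/
def conjLin {n : ℕ} (R : Matrix (Fin n) (Fin n) ℝ) : SymMat n →ₗ[ℝ] SymMat n where
  toFun r := symPart (R * mat r * Rᵀ)
  map_add' r s := by
    have : R * mat (r + s) * Rᵀ = R * mat r * Rᵀ + R * mat s * Rᵀ := by
      rw [← add_mul, ← mul_add]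
      rfl
    rw [this]
    exact (symPartLin n).map_add _ _
  map_smul' c r := by
    have : R * mat (c • r) * Rᵀ = c • (R * mat r * Rᵀ) := by
      have h : mat (c • r) = c • mat r := rfl
      rw [h, Matrix.mul_smul, Matrix.smul_mul]
    rw [this]
    exact (symPartLin n).map_smul _ _

lemma mat_conjLin {n : ℕ} (R : Matrix (Fin n) (Fin n) ℝ) (r : SymMat n) :
    mat (conjLin R r) = R * mat r * Rᵀ := by
  refine mat_symPart_of_symm ?_
  simp [Matrix.transpose_mul, mat_transpose, Matrix.mul_assoc]

lemma conjLin_symPart {n : ℕ} (R X : Matrix (Fin n) (Fin n) ℝ) :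
    conjLin R (symPart X) = symPart (R * X * Rᵀ) := by
  have h1 : mat (symPart X) = (1 / 2 : ℝ) • (X + Xᵀ) := by
    ext i j
    simp only [mat, symPart, Matrix.of_apply, Matrix.smul_apply, Matrix.add_apply,
      Matrix.transpose_apply, smul_eq_mul]
    ring
  have h2 : R * mat (symPart X) * Rᵀ = (1 / 2 : ℝ) • (R * X * Rᵀ + (R * X * Rᵀ)ᵀ) := by
    rw [h1]
    simp [Matrix.transpose_mul, Matrix.mul_add, Matrix.add_mul, Matrix.mul_assoc]
  change symPart (R * mat (symPart X) * Rᵀ) = _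
  rw [h2]
  ext i j
  simp only [symPart, Matrix.smul_apply, Matrix.add_apply, Matrix.transpose_apply, smul_eq_mul]
  ring

lemma exists_eigen_decomposition {n : ℕ} (r : SymMat n) :
    ∃ Q ∈ Matrix.orthogonalGroup (Fin n) ℝ, ∃ l : Fin n → ℝ,
      mat r = Q * Matrix.diagonal l * Qᵀ := by
  have hr : (mat r).IsHermitian := by
    rw [Matrix.IsHermitian, Matrix.conjTranspose_eq_transpose_of_trivial]
    exact mat_transpose r
  refine ⟨hr.eigenvectorUnitary, hr.eigenvectorUnitary.2, hr.eigenvalues, ?_⟩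
  have h := hr.spectral_theorem
  rw [Unitary.conjStarAlgAut_apply] at h
  exact h

lemma OrthInvariant.apply_conj {n : ℕ} {Γ : Set (SymMat n)} {F : SymMat n → ℝ}
    (h : OrthInvariant Γ F) {R : Matrix (Fin n) (Fin n) ℝ}
    (hR : R ∈ Matrix.orthogonalGroup (Fin n) ℝ) {r : SymMat n} (hr : r ∈ Γ) :
    F (conjLin R r) = F r := by
  obtain ⟨hΓ, f, -, hf⟩ := h
  obtain ⟨Q, hQ, l, hl⟩ := exists_eigen_decomposition r
  rw [hf r hr Q hQ l hl]
  refine hf _ (hΓ R hR r hr _ (mat_conjLin R r)) (R * Q) (mul_mem hR hQ) l ?_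
  rw [mat_conjLin, hl, Matrix.transpose_mul]
  simp only [Matrix.mul_assoc]

/-- Differentiating `F (R r Rᵀ) = F r` at a fixed point `w` of the conjugation. -/
lemma OrthInvariant.fderiv_conj {n : ℕ} {Γ : Set (SymMat n)} {F : SymMat n → ℝ}
    (h : OrthInvariant Γ F) (hΓ : IsOpen Γ) {R : Matrix (Fin n) (Fin n) ℝ}
    (hR : R ∈ Matrix.orthogonalGroup (Fin n) ℝ) {w : SymMat n} (hw : w ∈ Γ)
    (hF : DifferentiableAt ℝ F w) (hfix : conjLin R w = w) (η : SymMat n) :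
    fderiv ℝ F w (conjLin R η) = fderiv ℝ F w η := by
  let c : SymMat n →L[ℝ] SymMat n := (conjLin R).toContinuousLinearMap
  have heq : (fun r => F (c r)) =ᶠ[𝓝 w] F := by
    filter_upwards [hΓ.mem_nhds hw] with r hr
    exact h.apply_conj hR hr
  have hcw : c w = w := hfix
  have hd : HasFDerivAt (fun r => F (c r)) ((fderiv ℝ F w).comp c) w := by
    have h1 : HasFDerivAt F (fderiv ℝ F w) (c w) := by
      rw [hcw]
      exact hF.hasFDerivAt
    exact h1.comp w c.hasFDerivAt
  have h2 := heq.fderiv_eq (𝕜 := ℝ)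
  rw [hd.fderiv] at h2
  exact DFunLike.congr_fun h2 η

/-- In an orthonormal frame that diagonalizes `w`, the matrix `F_r(w)` is diagonal too: it commutes
with the reflections in the coordinate hyperplanes of the frame. -/
lemma OrthInvariant.isDiag_Fr {n : ℕ} {Γ : Set (SymMat n)} {F : SymMat n → ℝ}
    (h : OrthInvariant Γ F) (hΓ : IsOpen Γ) {w : SymMat n} (hw : w ∈ Γ)
    (hF : DifferentiableAt ℝ F w) {Q : Matrix (Fin n) (Fin n) ℝ}
    (hQ : Q ∈ Matrix.orthogonalGroup (Fin n) ℝ) (hd : (Qᵀ * mat w * Q).IsDiag) :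
    (Qᵀ * Fr F w * Q).IsDiag := by
  intro s t hst
  have hQ1 : Qᵀ * Q = 1 := (Matrix.mem_orthogonalGroup_iff' (Fin n) ℝ).1 hQ
  have hQ2 : Q * Qᵀ = 1 := (Matrix.mem_orthogonalGroup_iff (Fin n) ℝ).1 hQ
  -- `R` reflects the `s`-th vector of the frame; it fixes `w` and changes the sign of the symmetric
  -- matrix whose pairing with `F_r` is the `(s, t)` entry
  set d : Fin n → ℝ := fun i => if i = s then -1 else 1 with hdd
  have hdsq : ∀ i, d i * d i = 1 := fun i => by
    simp only [hdd]
    split_ifs <;> norm_num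
  set D : Matrix (Fin n) (Fin n) ℝ := Matrix.diagonal d with hD
  have hDD : D * D = 1 := by
    simp only [hD, Matrix.diagonal_mul_diagonal, hdsq, Matrix.diagonal_one]
  have hDt : Dᵀ = D := Matrix.diagonal_transpose d
  set R := Q * D * Qᵀ with hRdef
  have hRt : Rᵀ = R := by
    simp [hRdef, Matrix.transpose_mul, hDt, Matrix.mul_assoc]
  have hconj : ∀ X : Matrix (Fin n) (Fin n) ℝ, R * (Q * X * Qᵀ) * Rᵀ = Q * (D * X * D) * Qᵀ := by
    intro X
    rw [hRt, hRdef]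
    calc Q * D * Qᵀ * (Q * X * Qᵀ) * (Q * D * Qᵀ)
        = Q * D * (Qᵀ * Q) * X * (Qᵀ * Q) * D * Qᵀ := by simp only [Matrix.mul_assoc]
      _ = Q * (D * X * D) * Qᵀ := by
          rw [hQ1]
          simp only [Matrix.mul_one, Matrix.mul_assoc]
  have hR : R ∈ Matrix.orthogonalGroup (Fin n) ℝ := by
    rw [Matrix.mem_orthogonalGroup_iff]
    have h1 := hconj 1
    rw [Matrix.mul_one, hQ2, Matrix.mul_one, Matrix.mul_one, hDD, Matrix.mul_one, hQ2] at h1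
    exact h1
  have hwdec : mat w = Q * (Qᵀ * mat w * Q) * Qᵀ := by
    calc mat w = (Q * Qᵀ) * mat w * (Q * Qᵀ) := by rw [hQ2, Matrix.one_mul, Matrix.mul_one]
      _ = _ := by simp only [Matrix.mul_assoc]
  have hfix : conjLin R w = w := by
    have h1 : R * mat w * Rᵀ = mat w := by
      conv_lhs => rw [hwdec]
      rw [hconj]
      have h2 : D * (Qᵀ * mat w * Q) * D = Qᵀ * mat w * Q := by
        rw [← (Matrix.isDiag_iff_diagonal_diag _).1 hd, hD, Matrix.diagonal_mul_diagonal,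
          Matrix.diagonal_mul_diagonal]
        congr 1
        ext i
        rw [mul_comm (d i), mul_assoc, hdsq, mul_one]
      rw [h2, ← hwdec]
    change symPart (R * mat w * Rᵀ) = w
    rw [h1, symPart_mat]
  set X : Matrix (Fin n) (Fin n) ℝ := Matrix.single s t 1 with hX
  have hDX : D * X * D = -X := by
    ext i j
    rw [hD, Matrix.mul_diagonal, Matrix.diagonal_mul, Matrix.neg_apply, hX, Matrix.single_apply]
    split_ifs with hij
    · simp [hdd, ← hij.1, ← hij.2, Ne.symm hst]
    · simp
  have key := h.fderiv_conj hΓ hR hw hF hfix (symPart (Q * X * Qᵀ))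
  have hneg : symPart (Q * (-X) * Qᵀ) = -symPart (Q * X * Qᵀ) := by
    rw [Matrix.mul_neg, Matrix.neg_mul]
    exact (symPartLin n).map_neg _
  rw [conjLin_symPart, hconj, hDX, hneg, map_neg] at key
  have hval : (Qᵀ * Fr F w * Q) s t = fderiv ℝ F w (symPart (Q * X * Qᵀ)) := by
    rw [← sum_Fr_mul]
    have hXe : ∀ i j, (Q * X * Qᵀ) i j = Q i s * Q j t := fun i j => by
      rw [hX, Matrix.mul_apply, Finset.sum_eq_single t]
      · simp
      · intro b _ hb
        simp [hb]
      · simp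
    simp only [hXe, Matrix.mul_apply, Matrix.transpose_apply, Finset.sum_mul]
    rw [Finset.sum_comm]
    refine Finset.sum_congr rfl fun i _ => Finset.sum_congr rfl fun j _ => ?_
    ring
  rw [hval]
  linarith

/-- A common orthonormal eigenframe `q` of the matrix `G` representing the linear form `L` on
symmetric matrices (eigenvalues `lam ≥ 0`) and of the symmetric matrix `w` (eigenvalues `mu`). -/
structure SpectralFrame {n : ℕ} (L : SymMat n →L[ℝ] ℝ) (G : Matrix (Fin n) (Fin n) ℝ)
    (w : SymMat n) (q : Fin n → E n) (lam mu : Fin n → ℝ) : Prop where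
  orthonormal : Orthonormal ℝ q
  lam_nonneg : ∀ s, 0 ≤ lam s
  matrix_apply : ∀ i j, G i j = ∑ s, lam s * q s i * q s j
  form_apply : ∀ r, L r = ∑ s, lam s * bil r (q s) (q s)
  eigen : ∀ s i, ∑ j, mat w i j * q s j = mu s * q s i

lemma exists_spectralFrame {n : ℕ} {Γ : Set (SymMat n)} {F : SymMat n → ℝ} {a₀ : EReal}
    (hF : BasicConditions Γ F a₀) (h : OrthInvariant Γ F) {w : SymMat n} (hw : w ∈ Γ)
    {Q : Matrix (Fin n) (Fin n) ℝ}
    (hQ : Q ∈ Matrix.orthogonalGroup (Fin n) ℝ) (hd : (Qᵀ * mat w * Q).IsDiag) :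
    ∃ (q : Fin n → E n) (lam mu : Fin n → ℝ),
      SpectralFrame (fderiv ℝ F w) (Fr F w) w q lam mu ∧
      Tstar F w Q = ∑ s, lam s * (1 + |mu s|) := by
  have hFd : DifferentiableAt ℝ F w :=
    (hF.contDiff.contDiffAt (hF.isOpen.mem_nhds hw)).differentiableAt (by norm_num)
  have hQ1 : Qᵀ * Q = 1 := (Matrix.mem_orthogonalGroup_iff' (Fin n) ℝ).1 hQ
  have hQ2 : Q * Qᵀ = 1 := (Matrix.mem_orthogonalGroup_iff (Fin n) ℝ).1 hQ
  have hdF := h.isDiag_Fr hF.isOpen hw hFd hQ hd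
  set lam : Fin n → ℝ := fun s => (Qᵀ * Fr F w * Q) s s with hlam
  set mu : Fin n → ℝ := fun s => (Qᵀ * mat w * Q) s s with hmu
  have hdF' : Qᵀ * Fr F w * Q = Matrix.diagonal lam :=
    ((Matrix.isDiag_iff_diagonal_diag _).1 hdF).symm
  have hd' : Qᵀ * mat w * Q = Matrix.diagonal mu :=
    ((Matrix.isDiag_iff_diagonal_diag _).1 hd).symm
  have hFr : Fr F w = Q * Matrix.diagonal lam * Qᵀ := by
    rw [← hdF']
    calc Fr F w = (Q * Qᵀ) * Fr F w * (Q * Qᵀ) := by rw [hQ2, Matrix.one_mul, Matrix.mul_one]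
      _ = _ := by simp only [Matrix.mul_assoc]
  have hwQ : mat w * Q = Q * Matrix.diagonal mu := by
    rw [← hd']
    calc mat w * Q = (Q * Qᵀ) * mat w * Q := by rw [hQ2, Matrix.one_mul]
      _ = _ := by simp only [Matrix.mul_assoc]
  have hG : ∀ i j, Fr F w i j = ∑ s, lam s * Q i s * Q j s := fun i j => by
    rw [hFr, Matrix.mul_apply]
    refine Finset.sum_congr rfl fun s _ => ?_
    rw [Matrix.mul_diagonal, Matrix.transpose_apply]
    ring
  refine ⟨fun s => WithLp.toLp 2 fun i => Q i s, lam, mu, ⟨?_, ?_, hG, ?_, ?_⟩, rfl⟩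
  · rw [orthonormal_iff_ite]
    intro s t
    have := congrFun (congrFun hQ1 s) t
    rw [Matrix.one_apply] at this
    rw [← this, Matrix.mul_apply]
    simp [PiLp.inner_apply, mul_comm]
  · intro s
    have hps := ((hF.F1 w hw).posSemidef.conjTranspose_mul_mul_same Q)
    rw [Matrix.conjTranspose_eq_transpose_of_trivial] at hps
    exact hps.diag_nonneg
  · intro r
    rw [← sum_Fr_mul_mat]
    simp only [hG, bil, Finset.mul_sum, Finset.sum_mul]
    rw [Finset.sum_congr rfl fun i _ => Finset.sum_comm, Finset.sum_comm]
    refine Finset.sum_congr rfl fun s _ => Finset.sum_congr rfl fun i _ =>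
      Finset.sum_congr rfl fun j _ => ?_
    ring
  · intro s i
    have := congrFun (congrFun hwQ i) s
    rw [Matrix.mul_diagonal, Matrix.mul_apply] at this
    rw [this]
    exact mul_comm _ _

namespace SpectralFrame

variable {n : ℕ} {L : SymMat n →L[ℝ] ℝ} {G : Matrix (Fin n) (Fin n) ℝ} {w : SymMat n}
  {q : Fin n → E n} {lam mu : Fin n → ℝ}

lemma sum_nonneg (h : SpectralFrame L G w q lam mu) : 0 ≤ ∑ s, lam s :=
  Finset.sum_nonneg fun s _ => h.lam_nonneg s

lemma abs_form_le (h : SpectralFrame L G w q lam mu) (r : SymMat n) :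
    |L r| ≤ (n : ℝ) ^ 2 * ‖r‖ * ∑ s, lam s := by
  rw [h.form_apply, Finset.mul_sum]
  refine (Finset.abs_sum_le_sum_abs _ _).trans (Finset.sum_le_sum fun s _ => ?_)
  rw [abs_mul, abs_of_nonneg (h.lam_nonneg s), mul_comm]
  have := abs_bil_le r (q s) (q s)
  rw [h.orthonormal.1 s, mul_one, mul_one] at this
  exact mul_le_mul_of_nonneg_right this (h.lam_nonneg s)

lemma bil_eigen (h : SpectralFrame L G w q lam mu) (s : Fin n) : bil w (q s) (q s) = mu s := by
  have h1 : bil w (q s) (q s) = ∑ i, q s i * (mu s * q s i) := by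
    simp only [bil, ← h.eigen, Finset.mul_sum]
    refine Finset.sum_congr rfl fun i _ => Finset.sum_congr rfl fun j _ => ?_
    ring
  have h2 : ∑ i, q s i ^ 2 = 1 := by
    have := EuclideanSpace.real_norm_sq_eq (q s)
    rw [h.orthonormal.1 s] at this
    linarith
  rw [h1]
  calc ∑ i, q s i * (mu s * q s i) = mu s * ∑ i, q s i ^ 2 := by
        rw [Finset.mul_sum]
        exact Finset.sum_congr rfl fun i _ => by ring
    _ = mu s := by rw [h2, mul_one]

lemma form_self (h : SpectralFrame L G w q lam mu) : L w = ∑ s, lam s * mu s := by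
  rw [h.form_apply]
  exact Finset.sum_congr rfl fun s _ => by rw [h.bil_eigen]

lemma trace_eq (h : SpectralFrame L G w q lam mu) : G.trace = ∑ s, lam s := by
  simp only [Matrix.trace, Matrix.diag_apply, h.matrix_apply]
  rw [Finset.sum_comm]
  refine Finset.sum_congr rfl fun s _ => ?_
  have := EuclideanSpace.real_norm_sq_eq (q s)
  rw [h.orthonormal.1 s, one_pow] at this
  calc ∑ i, lam s * q s i * q s i = lam s * ∑ i, q s i ^ 2 := by
        rw [Finset.mul_sum]
        exact Finset.sum_congr rfl fun i _ => by ring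
    _ = lam s := by rw [← this, mul_one]

end SpectralFrame

/-! ### Second-order operators along a frame -/

section Calculus

variable {X Y : Type*} [NormedAddCommGroup X] [NormedSpace ℝ X] [NormedAddCommGroup Y]

lemma contDiffAt_fderiv [NormedSpace ℝ Y] {f : X → Y} {x : X} {m k : WithTop ℕ∞}
    (h : ContDiffAt ℝ k f x) (hk : m + 1 ≤ k) : ContDiffAt ℝ m (fderiv ℝ f) x :=
  h.fderiv_right hk

lemma differentiableAt_fderiv [NormedSpace ℝ Y] {f : X → Y} {x : X} (h : ContDiffAt ℝ 2 f x) :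
    DifferentiableAt ℝ (fderiv ℝ f) x :=
  (contDiffAt_fderiv (m := 1) h (by norm_num)).differentiableAt (by norm_num)

lemma eventually_differentiableAt [NormedSpace ℝ Y] {f : X → Y} {x : X}
    (h : ContDiffAt ℝ 2 f x) : ∀ᶠ y in 𝓝 x, DifferentiableAt ℝ f y :=
  (h.eventually (by simp)).mono fun _ hy => hy.differentiableAt (by norm_num)

lemma fderiv_fderiv_apply [NormedSpace ℝ Y] {f : X → Y} {x : X} (h : ContDiffAt ℝ 2 f x)
    (v c : X) : fderiv ℝ (fun y => fderiv ℝ f y c) x v = fderiv ℝ (fderiv ℝ f) x v c := by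
  have := (differentiableAt_fderiv h).hasFDerivAt.clm_apply (hasFDerivAt_const c x)
  rw [this.fderiv]
  simp

lemma contDiffAt_fderiv_apply [NormedSpace ℝ Y] {f : X → Y} {x : X} {m k : WithTop ℕ∞}
    (h : ContDiffAt ℝ k f x) (hk : m + 1 ≤ k) (c : X) :
    ContDiffAt ℝ m (fun y => fderiv ℝ f y c) x :=
  (contDiffAt_fderiv h hk).clm_apply contDiffAt_const

lemma fderiv_fderiv_symm [NormedSpace ℝ Y] {f : X → Y} {x : X} (h : ContDiffAt ℝ 2 f x)
    (v c : X) : fderiv ℝ (fderiv ℝ f) x v c = fderiv ℝ (fderiv ℝ f) x c v :=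
  (h.isSymmSndFDerivAt (by simp)).eq v c

lemma fderiv_fderiv_eq_of_eventuallyEq [NormedSpace ℝ Y] {f g : X → Y} {x : X}
    (h : f =ᶠ[𝓝 x] g) : fderiv ℝ (fderiv ℝ f) x = fderiv ℝ (fderiv ℝ g) x :=
  h.fderiv.fderiv_eq

lemma fderiv_fderiv_inner [InnerProductSpace ℝ Y] {f g : X → Y} {x : X} (hf : ContDiffAt ℝ 2 f x)
    (hg : ContDiffAt ℝ 2 g x) (e : X) :
    fderiv ℝ (fderiv ℝ fun y => inner ℝ (f y) (g y)) x e e =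
      inner ℝ (fderiv ℝ (fderiv ℝ f) x e e) (g x) + inner ℝ (f x) (fderiv ℝ (fderiv ℝ g) x e e) +
        2 * inner ℝ (fderiv ℝ f x e) (fderiv ℝ g x e) := by
  have hfg : ContDiffAt ℝ 2 (fun y => inner ℝ (f y) (g y)) x := hf.inner ℝ hg
  rw [← fderiv_fderiv_apply hfg]
  have heq : (fun y => fderiv ℝ (fun y => inner ℝ (f y) (g y)) y e) =ᶠ[𝓝 x]
      fun y => inner ℝ (f y) (fderiv ℝ g y e) + inner ℝ (fderiv ℝ f y e) (g y) := by
    filter_upwards [eventually_differentiableAt hf, eventually_differentiableAt hg] with y h1 h2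
    rw [fderiv_inner_apply ℝ h1 h2]
  have hf0 := hf.differentiableAt (by norm_num)
  have hg0 := hg.differentiableAt (by norm_num)
  have hf1 : DifferentiableAt ℝ (fun y => fderiv ℝ f y e) x :=
    (contDiffAt_fderiv_apply (m := 1) hf (by norm_num) e).differentiableAt (by norm_num)
  have hg1 : DifferentiableAt ℝ (fun y => fderiv ℝ g y e) x :=
    (contDiffAt_fderiv_apply (m := 1) hg (by norm_num) e).differentiableAt (by norm_num)
  rw [heq.fderiv_eq, fderiv_fun_add (hf0.inner ℝ hg1) (hf1.inner ℝ hg0),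
    add_apply, fderiv_inner_apply ℝ hf0 hg1, fderiv_inner_apply ℝ hf1 hg0,
    fderiv_fderiv_apply hf, fderiv_fderiv_apply hg]
  ring

lemma fderiv_fderiv_exp {f : X → ℝ} {x : X} (hf : ContDiffAt ℝ 2 f x) (e : X) :
    fderiv ℝ (fderiv ℝ fun y => Real.exp (f y)) x e e =
      Real.exp (f x) * (fderiv ℝ (fderiv ℝ f) x e e + fderiv ℝ f x e ^ 2) := by
  have hE : ContDiffAt ℝ 2 (fun y => Real.exp (f y)) x := hf.exp
  rw [← fderiv_fderiv_apply hE]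
  have heq : (fun y => fderiv ℝ (fun y => Real.exp (f y)) y e) =ᶠ[𝓝 x]
      fun y => Real.exp (f y) * fderiv ℝ f y e := by
    filter_upwards [eventually_differentiableAt hf] with y h1
    rw [fderiv_exp h1]
    simp
  have hf0 := hf.differentiableAt (by norm_num)
  have hf1 : DifferentiableAt ℝ (fun y => fderiv ℝ f y e) x :=
    (contDiffAt_fderiv_apply (m := 1) hf (by norm_num) e).differentiableAt (by norm_num)
  rw [heq.fderiv_eq, fderiv_fun_mul hf0.exp hf1, fderiv_exp hf0]
  simp only [add_apply, smul_apply, smul_eq_mul,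
    fderiv_fderiv_apply hf]
  ring

lemma fderiv_fderiv_add [NormedSpace ℝ Y] {f g : X → Y} {x : X} (hf : ContDiffAt ℝ 2 f x)
    (hg : ContDiffAt ℝ 2 g x) : fderiv ℝ (fderiv ℝ fun y => f y + g y) x =
      fderiv ℝ (fderiv ℝ f) x + fderiv ℝ (fderiv ℝ g) x := by
  have heq : fderiv ℝ (fun y => f y + g y) =ᶠ[𝓝 x] fun y => fderiv ℝ f y + fderiv ℝ g y := by
    filter_upwards [eventually_differentiableAt hf, eventually_differentiableAt hg] with y h1 h2
    exact fderiv_fun_add h1 h2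
  rw [heq.fderiv_eq, fderiv_fun_add (differentiableAt_fderiv hf) (differentiableAt_fderiv hg)]

lemma fderiv_fderiv_const_smul [NormedSpace ℝ Y] {f : X → Y} {x : X} (hf : ContDiffAt ℝ 2 f x)
    (c : ℝ) : fderiv ℝ (fderiv ℝ fun y => c • f y) x = c • fderiv ℝ (fderiv ℝ f) x := by
  have heq : fderiv ℝ (fun y => c • f y) =ᶠ[𝓝 x] fun y => c • fderiv ℝ f y := by
    filter_upwards [eventually_differentiableAt hf] with y h1
    exact fderiv_fun_const_smul h1 c
  rw [heq.fderiv_eq, fderiv_fun_const_smul (differentiableAt_fderiv hf)]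

end Calculus

/-- The operator `f ↦ ∑ lam_s D²f(q_s, q_s) - Df(β)` on vector-valued functions. -/
def frameOp {n : ℕ} {Y : Type*} [NormedAddCommGroup Y] [NormedSpace ℝ Y] (q : Fin n → E n)
    (lam : Fin n → ℝ) (β : E n) (f : E n → Y) (x : E n) : Y :=
  (∑ s, lam s • fderiv ℝ (fderiv ℝ f) x (q s) (q s)) - fderiv ℝ f x β

section FrameOp

variable {n : ℕ} {Y : Type*} [NormedAddCommGroup Y] {q : Fin n → E n} {lam : Fin n → ℝ} {β : E n}
  {x : E n}

lemma frameOp_congr [NormedSpace ℝ Y] {f g : E n → Y} (h : f =ᶠ[𝓝 x] g) :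
    frameOp q lam β f x = frameOp q lam β g x := by
  unfold frameOp
  rw [fderiv_fderiv_eq_of_eventuallyEq h, h.fderiv_eq]

lemma frameOp_add [NormedSpace ℝ Y] {f g : E n → Y} (hf : ContDiffAt ℝ 2 f x)
    (hg : ContDiffAt ℝ 2 g x) : frameOp q lam β (fun y => f y + g y) x =
      frameOp q lam β f x + frameOp q lam β g x := by
  unfold frameOp
  rw [fderiv_fderiv_add hf hg, fderiv_fun_add (hf.differentiableAt (by norm_num))
    (hg.differentiableAt (by norm_num))]
  simp only [add_apply, smul_add, Finset.sum_add_distrib]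
  abel

lemma frameOp_const_smul [NormedSpace ℝ Y] {f : E n → Y} (hf : ContDiffAt ℝ 2 f x) (c : ℝ) :
    frameOp q lam β (fun y => c • f y) x = c • frameOp q lam β f x := by
  unfold frameOp
  rw [fderiv_fderiv_const_smul hf, fderiv_fun_const_smul (hf.differentiableAt (by norm_num))]
  simp only [smul_apply, smul_sub, Finset.smul_sum]
  congr 1
  exact Finset.sum_congr rfl fun s _ => smul_comm _ _ _

lemma frameOp_const_mul {f : E n → ℝ} (hf : ContDiffAt ℝ 2 f x) (c : ℝ) :
    frameOp q lam β (fun y => c * f y) x = c * frameOp q lam β f x :=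
  frameOp_const_smul hf c

lemma frameOp_inner [InnerProductSpace ℝ Y] {f g : E n → Y} (hf : ContDiffAt ℝ 2 f x)
    (hg : ContDiffAt ℝ 2 g x) : frameOp q lam β (fun y => inner ℝ (f y) (g y)) x =
      inner ℝ (frameOp q lam β f x) (g x) + inner ℝ (f x) (frameOp q lam β g x) +
        2 * ∑ s, lam s * inner ℝ (fderiv ℝ f x (q s)) (fderiv ℝ g x (q s)) := by
  unfold frameOp
  simp only [fderiv_fderiv_inner hf hg]
  rw [fderiv_inner_apply ℝ (hf.differentiableAt (by norm_num)) (hg.differentiableAt (by norm_num))]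
  simp only [inner_sub_left, inner_sub_right, sum_inner, inner_sum, inner_smul_left,
    inner_smul_right, smul_eq_mul, mul_add, Finset.sum_add_distrib, Finset.mul_sum,
    RCLike.conj_to_real]
  have : ∑ s, lam s * (2 * inner ℝ (fderiv ℝ f x (q s)) (fderiv ℝ g x (q s))) =
      ∑ s, 2 * (lam s * inner ℝ (fderiv ℝ f x (q s)) (fderiv ℝ g x (q s))) :=
    Finset.sum_congr rfl fun s _ => by ring
  rw [this]
  ring

lemma frameOp_inner_const [InnerProductSpace ℝ Y] {f : E n → Y} (hf : ContDiffAt ℝ 2 f x)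
    (c : Y) : frameOp q lam β (fun y => inner ℝ (f y) c) x = inner ℝ (frameOp q lam β f x) c := by
  rw [frameOp_inner hf contDiffAt_const]
  have h1 : frameOp q lam β (fun _ : E n => c) x = 0 := by
    simp [frameOp]
  simp [h1]

lemma frameOp_exp {f : E n → ℝ} (hf : ContDiffAt ℝ 2 f x) :
    frameOp q lam β (fun y => Real.exp (f y)) x =
      Real.exp (f x) * (frameOp q lam β f x + ∑ s, lam s * fderiv ℝ f x (q s) ^ 2) := by
  unfold frameOp
  simp only [fderiv_fderiv_exp hf]
  rw [fderiv_exp (hf.differentiableAt (by norm_num))]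
  simp only [smul_apply, smul_eq_mul, mul_add, mul_sub, Finset.mul_sum,
    Finset.sum_add_distrib]
  have h1 : ∀ a : Fin n → ℝ, ∑ s, lam s * (Real.exp (f x) * a s) =
      ∑ s, Real.exp (f x) * (lam s * a s) := fun a =>
    Finset.sum_congr rfl fun s _ => by ring
  rw [h1, h1]
  ring

end FrameOp

/-! ### Gradients and coordinates -/

section Gradient

variable {n : ℕ} {u : E n → ℝ} {x : E n}

lemma contDiffAt_gradient {m k : WithTop ℕ∞} (h : ContDiffAt ℝ k u x) (hk : m + 1 ≤ k) :
    ContDiffAt ℝ m (∇ u) x :=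
  ((InnerProductSpace.toDual ℝ (E n)).symm.contDiff.contDiffAt).comp x (contDiffAt_fderiv h hk)

lemma inner_fderiv_gradient (h : ContDiffAt ℝ 2 u x) (v c : E n) :
    inner ℝ (fderiv ℝ (∇ u) x v) c = fderiv ℝ (fderiv ℝ u) x v c := by
  rw [← fderiv_fderiv_apply h]
  have h1 : (fun y => fderiv ℝ u y c) = fun y => inner ℝ (∇ u y) c := by
    ext y
    rw [inner_gradient_left]
  have hd : DifferentiableAt ℝ (∇ u) x :=
    (contDiffAt_gradient (m := 1) h (by norm_num)).differentiableAt (by norm_num)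
  rw [h1, fderiv_inner_apply ℝ hd (differentiableAt_const c)]
  simp

lemma inner_frameOp_gradient {q : Fin n → E n} {lam : Fin n → ℝ} {β : E n}
    (h : ContDiffAt ℝ 3 u x) (c : E n) :
    inner ℝ (frameOp q lam β (∇ u) x) c = frameOp q lam β (fun y => fderiv ℝ u y c) x := by
  rw [← frameOp_inner_const (contDiffAt_gradient (m := 2) h (by norm_num))]
  simp only [inner_gradient_left]

lemma sum_coord_smul_single (v : E n) :
    ∑ i, v i • (EuclideanSpace.single i 1 : E n) = v := by
  have := (EuclideanSpace.basisFun (Fin n) ℝ).sum_repr v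
  simpa using this

lemma clm_eq_sum {Y : Type*} [NormedAddCommGroup Y] [NormedSpace ℝ Y] (T : E n →L[ℝ] Y) (v : E n) :
    T v = ∑ i, v i • T (EuclideanSpace.single i 1) := by
  conv_lhs => rw [← sum_coord_smul_single v]
  simp only [map_sum, map_smul]

lemma pd_pd_eq {f : E n → ℝ} (h : ContDiffAt ℝ 2 f x) (i j : Fin n) :
    pd i (pd j f) x = fderiv ℝ (fderiv ℝ f) x (EuclideanSpace.single i 1)
      (EuclideanSpace.single j 1) :=
  fderiv_fderiv_apply h _ _

lemma mat_hess {f : E n → ℝ} (h : ContDiffAt ℝ 2 f x) (i j : Fin n) :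
    mat (hess f x) i j = pd i (pd j f) x := by
  have h2 : pd j (pd i f) x = pd i (pd j f) x := by
    rw [pd_pd_eq h, pd_pd_eq h, fderiv_fderiv_symm h]
  simp [mat, hess, symPart, h2]

lemma bil_hess {f : E n → ℝ} (h : ContDiffAt ℝ 2 f x) (ξ ζ : E n) :
    bil (hess f x) ξ ζ = fderiv ℝ (fderiv ℝ f) x ξ ζ := by
  rw [clm_eq_sum (fderiv ℝ (fderiv ℝ f) x) ξ]
  simp only [bil, mat_hess h, pd_pd_eq h, sum_apply,
    smul_apply, smul_eq_mul]
  refine Finset.sum_congr rfl fun i _ => ?_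
  rw [clm_eq_sum _ ζ, Finset.mul_sum]
  refine Finset.sum_congr rfl fun j _ => ?_
  simp only [smul_eq_mul]
  ring

end Gradient

/-! ### The linearized operator and the differentiated equation -/

section Linearized

variable {n : ℕ} {x : E n} {u : E n → ℝ}

/-- The vector representing the linear form `v ↦ L (A' v) + B' v`; it is the first-order
coefficient of the linearized operator, with the opposite sign. -/
def drift (L : SymMat n →L[ℝ] ℝ) (A' : E n →L[ℝ] SymMat n) (B' : E n →L[ℝ] ℝ) : E n :=
  (InnerProductSpace.toDual ℝ (E n)).symm (L.comp A' + B')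

lemma inner_drift (L : SymMat n →L[ℝ] ℝ) (A' : E n →L[ℝ] SymMat n) (B' : E n →L[ℝ] ℝ) (v : E n) :
    inner ℝ (drift L A' B') v = L (A' v) + B' v := by
  rw [drift, InnerProductSpace.toDual_symm_apply]
  simp

lemma fderiv_mat_apply {G : E n → SymMat n} {p : E n} (hG : DifferentiableAt ℝ G p) (i j : Fin n)
    (v : E n) : fderiv ℝ (fun q => mat (G q) i j) p v = mat (fderiv ℝ G p v) i j := by
  let ev : SymMat n →L[ℝ] ℝ := ((ContinuousLinearMap.proj j).comp
    (ContinuousLinearMap.proj (R := ℝ) (φ := fun _ : Fin n => Fin n → ℝ) i)).comp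
      (symSubmodule n).subtypeL
  have h := (ev.hasFDerivAt (x := G p)).comp p hG.hasFDerivAt
  have h2 : (fun q => mat (G q) i j) = ev ∘ G := rfl
  rw [h2, h.fderiv]
  rfl

lemma Ap_eq {A : E n → ℝ → E n → SymMat n} {z : ℝ} {p : E n}
    (hA : DifferentiableAt ℝ (A x z) p) (i j k : Fin n) :
    Ap A i j k x z p = mat (fderiv ℝ (A x z) p (EuclideanSpace.single k 1)) i j :=
  fderiv_mat_apply hA i j _

lemma linOp_eq_frameOp {F : SymMat n → ℝ} {A : E n → ℝ → E n → SymMat n} {B : E n → ℝ → E n → ℝ}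
    {q : Fin n → E n} {lam mu : Fin n → ℝ}
    (hfr : SpectralFrame (fderiv ℝ F (augHess A u x)) (Fr F (augHess A u x)) (augHess A u x)
      q lam mu)
    (hA : DifferentiableAt ℝ (A x (u x)) (∇ u x)) {f : E n → ℝ} (hf : ContDiffAt ℝ 2 f x) :
    linOp F A B u f x = frameOp q lam (drift (fderiv ℝ F (augHess A u x))
      (fderiv ℝ (A x (u x)) (∇ u x)) (fderiv ℝ (B x (u x)) (∇ u x))) f x := by
  set β := drift (fderiv ℝ F (augHess A u x))
      (fderiv ℝ (A x (u x)) (∇ u x)) (fderiv ℝ (B x (u x)) (∇ u x)) with hβ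
  unfold linOp frameOp
  congr 1
  · simp only [← mat_hess hf, sum_Fr_mul_mat, hfr.form_apply, bil_hess hf, smul_eq_mul]
  · rw [clm_eq_sum (fderiv ℝ f x) β]
    refine Finset.sum_congr rfl fun k _ => ?_
    simp only [Ap_eq hA, sum_Fr_mul_mat]
    have h1 : β k = inner ℝ β (EuclideanSpace.single k 1) := by
      simp [EuclideanSpace.inner_single_right]
    rw [h1, hβ, inner_drift]
    rfl

/-- Differentiation commutes with taking the Hessian. -/
lemma fderiv_hess (hu : ContDiffAt ℝ 3 u x) (c : E n) :
    DifferentiableAt ℝ (hess u) x ∧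
      fderiv ℝ (hess u) x c = hess (fun y => fderiv ℝ u y c) x := by
  have hpd : ∀ j, ContDiffAt ℝ 2 (pd j u) x := fun j =>
    contDiffAt_fderiv_apply hu (by norm_num) _
  have hpdd : ∀ i j, DifferentiableAt ℝ (pd i (pd j u)) x := fun i j =>
    (contDiffAt_fderiv_apply (m := 1) (hpd j) (by norm_num) _).differentiableAt (by norm_num)
  have hH : HasFDerivAt (fun y => fun i j => pd i (pd j u) y)
      (ContinuousLinearMap.pi fun i => ContinuousLinearMap.pi fun j =>
        fderiv ℝ (pd i (pd j u)) x) x := by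
    rw [hasFDerivAt_pi]
    intro i
    rw [hasFDerivAt_pi]
    exact fun j => (hpdd i j).hasFDerivAt
  have hh : HasFDerivAt (hess u) _ x :=
    ((symPartLin n).toContinuousLinearMap.hasFDerivAt).comp x hH
  refine ⟨hh.differentiableAt, ?_⟩
  rw [hh.fderiv]
  change symPart (fun i j => fderiv ℝ (pd i (pd j u)) x c) = symPart _
  congr 1
  ext i j
  have h1 : fderiv ℝ (pd i (pd j u)) x c =
      fderiv ℝ (fun y => fderiv ℝ (pd j u) y c) x (EuclideanSpace.single i 1) := by
    rw [fderiv_fderiv_apply (hpd j), fderiv_fderiv_symm (hpd j), ← fderiv_fderiv_apply (hpd j)]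
    rfl
  have h2 : (fun y => fderiv ℝ (pd j u) y c) =ᶠ[𝓝 x] pd j fun y => fderiv ℝ u y c := by
    filter_upwards [(hu.of_le (by norm_num : (2 : WithTop ℕ∞) ≤ 3)).eventually (by simp)]
      with y hy
    unfold pd
    rw [fderiv_fderiv_apply hy, fderiv_fderiv_symm hy, ← fderiv_fderiv_apply hy]
  rw [h1, h2.fderiv_eq]
  rfl

lemma hasFDerivAt_partial {Y : Type*} [NormedAddCommGroup Y] [NormedSpace ℝ Y]
    {A : E n → ℝ → E n → Y} {z : ℝ} {p : E n}
    (hA : DifferentiableAt ℝ (fun q : E n × ℝ × E n => A q.1 q.2.1 q.2.2) (x, z, p)) :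
    HasFDerivAt (A x z) ((fderiv ℝ (fun q : E n × ℝ × E n => A q.1 q.2.1 q.2.2) (x, z, p)).comp
      ((ContinuousLinearMap.inr ℝ (E n) (ℝ × E n)).comp (ContinuousLinearMap.inr ℝ ℝ (E n))))
      p := by
  have h : HasFDerivAt (fun p : E n => (x, z, p))
      ((ContinuousLinearMap.inr ℝ (E n) (ℝ × E n)).comp (ContinuousLinearMap.inr ℝ ℝ (E n))) p :=
    (hasFDerivAt_prodMk_right x (z, p)).comp p (hasFDerivAt_prodMk_right z p)
  exact HasFDerivAt.comp (g := fun q : E n × ℝ × E n => A q.1 q.2.1 q.2.2) p hA.hasFDerivAt h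

lemma fderiv_partial_apply {Y : Type*} [NormedAddCommGroup Y] [NormedSpace ℝ Y]
    {A : E n → ℝ → E n → Y} {z : ℝ} {p : E n}
    (hA : DifferentiableAt ℝ (fun q : E n × ℝ × E n => A q.1 q.2.1 q.2.2) (x, z, p)) (v : E n) :
    fderiv ℝ (A x z) p v =
      fderiv ℝ (fun q : E n × ℝ × E n => A q.1 q.2.1 q.2.2) (x, z, p) (0, 0, v) := by
  rw [(hasFDerivAt_partial hA).fderiv]
  rfl

lemma hasFDerivAt_comp_jet {Y : Type*} [NormedAddCommGroup Y] [NormedSpace ℝ Y]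
    {A : E n → ℝ → E n → Y} (hu : ContDiffAt ℝ 2 u x)
    (hA : DifferentiableAt ℝ (fun q : E n × ℝ × E n => A q.1 q.2.1 q.2.2) (x, u x, ∇ u x)) :
    HasFDerivAt (fun y => A y (u y) (∇ u y))
      ((fderiv ℝ (fun q : E n × ℝ × E n => A q.1 q.2.1 q.2.2) (x, u x, ∇ u x)).comp
        ((ContinuousLinearMap.id ℝ (E n)).prod
          ((fderiv ℝ u x).prod (fderiv ℝ (∇ u) x)))) x := by
  have hu0 : HasFDerivAt u (fderiv ℝ u x) x := (hu.differentiableAt (by norm_num)).hasFDerivAt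
  have hu1 : HasFDerivAt (∇ u) (fderiv ℝ (∇ u) x) x :=
    ((contDiffAt_gradient (m := 1) hu (by norm_num)).differentiableAt (by norm_num)).hasFDerivAt
  have h : HasFDerivAt (fun y => (y, u y, ∇ u y)) _ x :=
    (hasFDerivAt_id x).prodMk (hu0.prodMk hu1)
  exact HasFDerivAt.comp (g := fun q : E n × ℝ × E n => A q.1 q.2.1 q.2.2) x hA.hasFDerivAt h

/-- The equation `F(M[u]) = B(·, u, Du)` differentiated in the direction `c`: the terms that
contain second derivatives of `u` are those of the linearized operator. -/
lemma frameOp_fderiv_solution {F : SymMat n → ℝ} {A : E n → ℝ → E n → SymMat n}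
    {B : E n → ℝ → E n → ℝ} {q : Fin n → E n} {lam mu : Fin n → ℝ}
    (hfr : SpectralFrame (fderiv ℝ F (augHess A u x)) (Fr F (augHess A u x)) (augHess A u x)
      q lam mu)
    (hF : DifferentiableAt ℝ F (augHess A u x)) (hu : ContDiffAt ℝ 3 u x)
    (hA : DifferentiableAt ℝ (fun q : E n × ℝ × E n => A q.1 q.2.1 q.2.2) (x, u x, ∇ u x))
    (hB : DifferentiableAt ℝ (fun q : E n × ℝ × E n => B q.1 q.2.1 q.2.2) (x, u x, ∇ u x))
    (heq : ∀ᶠ y in 𝓝 x, F (augHess A u y) = B y (u y) (∇ u y)) (c : E n) :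
    frameOp q lam (drift (fderiv ℝ F (augHess A u x))
        (fderiv ℝ (A x (u x)) (∇ u x)) (fderiv ℝ (B x (u x)) (∇ u x)))
      (fun y => fderiv ℝ u y c) x =
    fderiv ℝ F (augHess A u x)
      (fderiv ℝ (fun q : E n × ℝ × E n => A q.1 q.2.1 q.2.2) (x, u x, ∇ u x)
        (c, fderiv ℝ u x c, 0)) +
    fderiv ℝ (fun q : E n × ℝ × E n => B q.1 q.2.1 q.2.2) (x, u x, ∇ u x)
      (c, fderiv ℝ u x c, 0) := by
  have hu2 : ContDiffAt ℝ 2 u x := hu.of_le (by norm_num)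
  have huc : ContDiffAt ℝ 2 (fun y => fderiv ℝ u y c) x :=
    contDiffAt_fderiv_apply hu (by norm_num) c
  obtain ⟨hh, hhc⟩ := fderiv_hess hu c
  set L := fderiv ℝ F (augHess A u x)
  set A' := fderiv ℝ (fun q : E n × ℝ × E n => A q.1 q.2.1 q.2.2) (x, u x, ∇ u x) with hA'
  set B' := fderiv ℝ (fun q : E n × ℝ × E n => B q.1 q.2.1 q.2.2) (x, u x, ∇ u x) with hB'
  set V := fderiv ℝ (∇ u) x c
  have hM := hh.hasFDerivAt.sub (hasFDerivAt_comp_jet hu2 hA)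
  have h1 : HasFDerivAt (fun y => F (augHess A u y)) _ x :=
    HasFDerivAt.comp (g := F) (f := augHess A u) x hF.hasFDerivAt hM
  have h2 := hasFDerivAt_comp_jet hu2 hB
  have h3 : fderiv ℝ (fun y => F (augHess A u y)) x = fderiv ℝ (fun y => B y (u y) (∇ u y)) x :=
    EventuallyEq.fderiv_eq heq
  rw [h1.fderiv, h2.fderiv] at h3
  have h4 := DFunLike.congr_fun h3 c
  have h5 : L (fderiv ℝ (hess u) x c - A' (c, fderiv ℝ u x c, V)) =
      B' (c, fderiv ℝ u x c, V) := h4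
  rw [hhc, map_sub, hfr.form_apply (hess _ x)] at h5
  have hsplit : ((c, fderiv ℝ u x c, V) : E n × ℝ × E n) =
      (c, fderiv ℝ u x c, 0) + (0, 0, V) := by simp
  rw [hsplit, map_add, map_add, map_add] at h5
  -- the first-order part of the operator accounts exactly for the terms with `V = D_c Du`
  have hdrift : fderiv ℝ (fun y => fderiv ℝ u y c) x (drift L (fderiv ℝ (A x (u x)) (∇ u x))
      (fderiv ℝ (B x (u x)) (∇ u x))) = L (A' (0, 0, V)) + B' (0, 0, V) := by
    rw [fderiv_fderiv_apply hu2, fderiv_fderiv_symm hu2, ← inner_fderiv_gradient hu2,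
      real_inner_comm, inner_drift, fderiv_partial_apply hA, fderiv_partial_apply hB]
  unfold frameOp
  rw [hdrift]
  simp only [bil_hess huc] at h5
  simp only [smul_eq_mul]
  linarith

end Linearized

/-! ### The tangential gradient -/

section Tangential

variable {n : ℕ}

/-- If the cosines `τ` of a unit vector with respect to an orthonormal frame are given, then at most
one of the factors `1 - τ_s²` is small. The weighted quadratic sum therefore controls all the terms
`lam_s |mu_s|` but one, and the last one is recovered from the bound on `∑ lam_s mu_s`. -/
lemma sum_mul_sq_ge {lam mu τ : Fin n → ℝ} {C D : ℝ} (hD : 0 ≤ D)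
    (hlam : ∀ s, 0 ≤ lam s) (hτ1 : ∀ s, τ s ^ 2 ≤ 1)
    (hτ : ∀ s t, s ≠ t → τ s ^ 2 + τ t ^ 2 ≤ 1)
    (hsum : |∑ s, lam s * mu s| ≤ C * (1 + ∑ s, lam s)) :
    (D + 1) * ∑ s, lam s * |mu s| - ((D + 1) * C + 2 * (D + 1) ^ 2) * (1 + ∑ s, lam s) ≤
      ∑ s, lam s * (mu s ^ 2 * (1 - τ s ^ 2)) := by
  set T := ∑ s, lam s with hT
  set S := ∑ s, lam s * |mu s| with hS
  have hT0 : 0 ≤ T := Finset.sum_nonneg fun s _ => hlam s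
  have hC : 0 ≤ C * (1 + T) := (abs_nonneg _).trans hsum
  -- The elementary inequality `N |m| - N² / 2 ≤ m² / 2` with `N = 2 (D + 1)`
  have helem : ∀ s, τ s ^ 2 ≤ 1 / 2 →
      lam s * (2 * (D + 1) * |mu s| - 2 * (D + 1) ^ 2) ≤ lam s * (mu s ^ 2 * (1 - τ s ^ 2)) := by
    intro s hs
    refine mul_le_mul_of_nonneg_left ?_ (hlam s)
    have h1 : mu s ^ 2 * (1 / 2) ≤ mu s ^ 2 * (1 - τ s ^ 2) :=
      mul_le_mul_of_nonneg_left (by linarith) (sq_nonneg _)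
    nlinarith [sq_nonneg (|mu s| - 2 * (D + 1)), sq_abs (mu s)]
  by_cases hall : ∀ s, τ s ^ 2 ≤ 1 / 2
  · have h1 : 2 * (D + 1) * S - 2 * (D + 1) ^ 2 * T ≤
        ∑ s, lam s * (mu s ^ 2 * (1 - τ s ^ 2)) := by
      have : 2 * (D + 1) * S - 2 * (D + 1) ^ 2 * T =
          ∑ s, lam s * (2 * (D + 1) * |mu s| - 2 * (D + 1) ^ 2) := by
        rw [hS, hT, Finset.mul_sum, Finset.mul_sum, ← Finset.sum_sub_distrib]
        exact Finset.sum_congr rfl fun s _ => by ring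
      rw [this]
      exact Finset.sum_le_sum fun s _ => helem s (hall s)
    have hS0 : 0 ≤ S := Finset.sum_nonneg fun s _ => mul_nonneg (hlam s) (abs_nonneg _)
    nlinarith [mul_nonneg (by linarith : (0 : ℝ) ≤ D + 1) hS0,
      mul_nonneg (by linarith : (0 : ℝ) ≤ D + 1) hC, sq_nonneg (D + 1)]
  · push Not at hall
    obtain ⟨i, hi⟩ := hall
    have hoth : ∀ s, s ≠ i → τ s ^ 2 ≤ 1 / 2 := fun s hs => by linarith [hτ s i hs]
    set S' := ∑ s ∈ Finset.univ.erase i, lam s * |mu s| with hS'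
    have hSsplit : S = lam i * |mu i| + S' := (Finset.add_sum_erase _ _ (Finset.mem_univ i)).symm
    have hmsplit : ∑ s, lam s * mu s = lam i * mu i + ∑ s ∈ Finset.univ.erase i, lam s * mu s :=
      (Finset.add_sum_erase _ _ (Finset.mem_univ i)).symm
    have hTsplit : T = lam i + ∑ s ∈ Finset.univ.erase i, lam s :=
      (Finset.add_sum_erase _ _ (Finset.mem_univ i)).symm
    have hrest : |∑ s ∈ Finset.univ.erase i, lam s * mu s| ≤ S' := by
      refine (Finset.abs_sum_le_sum_abs _ _).trans_eq (Finset.sum_congr rfl fun s _ => ?_)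
      rw [abs_mul, abs_of_nonneg (hlam s)]
    -- the exceptional term, from the bound on the sum without absolute values
    have hexc : lam i * |mu i| ≤ C * (1 + T) + S' := by
      have h1 : lam i * |mu i| = |lam i * mu i| := by rw [abs_mul, abs_of_nonneg (hlam i)]
      have h2 : lam i * mu i =
          ∑ s, lam s * mu s - ∑ s ∈ Finset.univ.erase i, lam s * mu s := by linarith
      rw [h1, h2]
      exact (abs_sub _ _).trans (add_le_add hsum hrest)
    have h1 : 2 * (D + 1) * S' - 2 * (D + 1) ^ 2 * T ≤
        ∑ s, lam s * (mu s ^ 2 * (1 - τ s ^ 2)) := by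
      have h2 : 2 * (D + 1) * S' - 2 * (D + 1) ^ 2 * ∑ s ∈ Finset.univ.erase i, lam s =
          ∑ s ∈ Finset.univ.erase i, lam s * (2 * (D + 1) * |mu s| - 2 * (D + 1) ^ 2) := by
        rw [hS', Finset.mul_sum, Finset.mul_sum, ← Finset.sum_sub_distrib]
        exact Finset.sum_congr rfl fun s _ => by ring
      have h3 : ∑ s ∈ Finset.univ.erase i, lam s * (2 * (D + 1) * |mu s| - 2 * (D + 1) ^ 2) ≤
          ∑ s ∈ Finset.univ.erase i, lam s * (mu s ^ 2 * (1 - τ s ^ 2)) :=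
        Finset.sum_le_sum fun s hs => helem s (hoth s (Finset.ne_of_mem_erase hs))
      rw [← Finset.add_sum_erase _ _ (Finset.mem_univ i)]
      have h4 : 0 ≤ lam i * (mu i ^ 2 * (1 - τ i ^ 2)) :=
        mul_nonneg (hlam i) (mul_nonneg (sq_nonneg _) (by linarith [hτ1 i]))
      nlinarith [mul_nonneg (sq_nonneg (D + 1)) (hlam i)]
    nlinarith [mul_nonneg (by linarith : (0 : ℝ) ≤ D + 1) (sub_nonneg.2 hexc), sq_nonneg (D + 1)]

lemma orthonormal_sq_inner_le {q : Fin n → E n} (hq : Orthonormal ℝ q) {v : E n} (hv : ‖v‖ = 1)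
    (s : Fin n) : inner ℝ (q s) v ^ 2 ≤ 1 := by
  have := hq.sum_inner_products_le v (s := {s})
  simpa [hv] using this

lemma orthonormal_sq_inner_add_sq_inner_le {q : Fin n → E n} (hq : Orthonormal ℝ q) {v : E n}
    (hv : ‖v‖ = 1) {s t : Fin n} (hst : s ≠ t) :
    inner ℝ (q s) v ^ 2 + inner ℝ (q t) v ^ 2 ≤ 1 := by
  have := hq.sum_inner_products_le v (s := {s, t})
  rw [Finset.sum_pair hst] at this
  simpa [hv] using this

lemma abs_inner_le_of_le {v w : E n} {a b : ℝ} (hv : ‖v‖ ≤ a) (hw : ‖w‖ ≤ b) :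
    |inner ℝ v w| ≤ a * b :=
  (abs_real_inner_le_norm v w).trans
    (mul_le_mul hv hw (norm_nonneg _) ((norm_nonneg _).trans hv))

/-- The contribution of one eigendirection to the quadratic terms of `𝓛 (|δu|² / 2)`. -/
lemma sq_norm_sub_sq_ge {q γ a : E n} {m b C : ℝ} (hq : ‖q‖ = 1) (hγ : ‖γ‖ = 1) (ha : ‖a‖ ≤ C)
    (hb : |b| ≤ C ^ 2) :
    m ^ 2 * (1 - inner ℝ q γ ^ 2) - (4 * C + 2 * C ^ 2 + (C + C ^ 2) ^ 2) * (1 + |m|) ≤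
      ‖m • q + a‖ ^ 2 - (inner ℝ (m • q + a) γ + b) ^ 2 := by
  have hC : 0 ≤ C := (norm_nonneg a).trans ha
  have h1 : ‖m • q + a‖ ^ 2 = m ^ 2 + 2 * (m * inner ℝ q a) + ‖a‖ ^ 2 := by
    rw [norm_add_sq_real, norm_smul, hq, inner_smul_left, mul_one, Real.norm_eq_abs, sq_abs]
    simp
  have h2 : inner ℝ (m • q + a) γ = m * inner ℝ q γ + inner ℝ a γ := by
    rw [inner_add_left, inner_smul_left]
    simp
  set τ := inner ℝ q γ with hτ
  set ab := inner ℝ a γ + b with hab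
  have hτ1 : |τ| ≤ 1 := by simpa using abs_inner_le_of_le hq.le hγ.le
  have hqa : |inner ℝ q a| ≤ C := by simpa using abs_inner_le_of_le hq.le ha
  have haγ : |inner ℝ a γ| ≤ C := by simpa using abs_inner_le_of_le ha hγ.le
  have hab1 : |ab| ≤ C + C ^ 2 := (abs_add_le _ _).trans (add_le_add haγ hb)
  have hm := abs_nonneg m
  have e1 : -(|m| * C) ≤ m * inner ℝ q a := by
    refine neg_le_of_abs_le ?_
    rw [abs_mul]
    exact mul_le_mul_of_nonneg_left hqa hm
  have e2 : m * τ * ab ≤ |m| * (C + C ^ 2) := by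
    refine le_of_abs_le ?_
    rw [abs_mul, abs_mul]
    calc |m| * |τ| * |ab| ≤ |m| * 1 * (C + C ^ 2) := by gcongr
      _ = _ := by ring
  have e3 : ab ^ 2 ≤ (C + C ^ 2) ^ 2 :=
    sq_le_sq.2 (by rwa [abs_of_nonneg (by positivity : 0 ≤ C + C ^ 2)])
  have h3 : ‖m • q + a‖ ^ 2 - (inner ℝ (m • q + a) γ + b) ^ 2 =
      m ^ 2 * (1 - τ ^ 2) + 2 * (m * inner ℝ q a) + ‖a‖ ^ 2 - 2 * (m * τ * ab) - ab ^ 2 := by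
    rw [h1, h2, hab]
    ring
  rw [h3]
  have p1 : 0 ≤ (C + C ^ 2) ^ 2 * |m| := by positivity
  have p2 : 0 ≤ ‖a‖ ^ 2 := by positivity
  have p3 : 0 ≤ C ^ 2 := by positivity
  nlinarith

/-- Lower bound for `𝓛 (|δu|² / 2)`, in terms of `p = Du`, `ℓ = 𝓛 Du`, `m = 𝓛 γ`, and the
derivatives `mu_s q_s + a_s` of `Du` and `g_s` of `γ` along the frame. -/
lemma tangential_lower_bound {C : ℝ} (hC : 0 ≤ C) :
    ∃ C' : ℝ, 0 ≤ C' ∧ ∀ (q a g U : Fin n → E n) (lam mu : Fin n → ℝ) (γ p ℓ m : E n),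
      Orthonormal ℝ q → (∀ s, 0 ≤ lam s) → ‖γ‖ = 1 → ‖p‖ ≤ C → (∀ s, ‖a s‖ ≤ C) →
      (∀ s, ‖g s‖ ≤ C) → ‖ℓ‖ ≤ C * (1 + ∑ s, lam s) → ‖m‖ ≤ C * (1 + ∑ s, lam s) →
      |∑ s, lam s * mu s| ≤ C * (1 + ∑ s, lam s) → (∀ s, U s = mu s • q s + a s) →
      ∑ s, lam s * |mu s| - C' * (1 + ∑ s, lam s) ≤
        inner ℝ p ℓ + ∑ s, lam s * ‖U s‖ ^ 2 -
          inner ℝ p γ * (inner ℝ ℓ γ + inner ℝ p m + 2 * ∑ s, lam s * inner ℝ (U s) (g s)) -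
          ∑ s, lam s * (inner ℝ (U s) γ + inner ℝ p (g s)) ^ 2 := by
  obtain ⟨c₁, hc₁⟩ : ∃ c, c = 4 * C + 2 * C ^ 2 + (C + C ^ 2) ^ 2 := ⟨_, rfl⟩
  have hc1T : 0 ≤ c₁ := by rw [hc₁]; positivity
  obtain ⟨D, hD⟩ : ∃ c, c = c₁ + 2 * C ^ 2 := ⟨_, rfl⟩
  have hD0 : 0 ≤ D := by rw [hD]; positivity
  obtain ⟨c₂, hc₂⟩ : ∃ c, c = C ^ 2 + C * (C + C ^ 2) + 2 * C ^ 3 + c₁ := ⟨_, rfl⟩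
  have hc2T : 0 ≤ c₂ := by rw [hc₂]; positivity
  refine ⟨(D + 1) * C + 2 * (D + 1) ^ 2 + c₂, by positivity, ?_⟩
  intro q a g U lam mu γ p ℓ m hq hlam hγ hp ha hg hℓ hm hsum hU
  have hmain := sum_mul_sq_ge (τ := fun s => inner ℝ (q s) γ) hD0 hlam
    (fun s => orthonormal_sq_inner_le hq hγ s)
    (fun s t hst => orthonormal_sq_inner_add_sq_inner_le hq hγ hst) hsum
  set T := ∑ s, lam s with hT
  set S := ∑ s, lam s * |mu s| with hS
  have hT0 : 0 ≤ T := Finset.sum_nonneg fun s _ => hlam s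
  have hS0 : 0 ≤ S := Finset.sum_nonneg fun s _ => mul_nonneg (hlam s) (abs_nonneg _)
  have hsumC : ∀ c : ℝ, ∑ s, lam s * (c * (1 + |mu s|)) = c * T + c * S := fun c => by
    rw [hT, hS, Finset.mul_sum, Finset.mul_sum, ← Finset.sum_add_distrib]
    exact Finset.sum_congr rfl fun s _ => by ring
  have hquad : ∑ s, lam s * (mu s ^ 2 * (1 - inner ℝ (q s) γ ^ 2)) - (c₁ * T + c₁ * S) ≤
      ∑ s, lam s * ‖U s‖ ^ 2 - ∑ s, lam s * (inner ℝ (U s) γ + inner ℝ p (g s)) ^ 2 := by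
    rw [← hsumC, ← Finset.sum_sub_distrib, ← Finset.sum_sub_distrib]
    refine Finset.sum_le_sum fun s _ => ?_
    rw [← mul_sub, ← mul_sub, hU s, hc₁]
    refine mul_le_mul_of_nonneg_left (sq_norm_sub_sq_ge (hq.1 s) hγ (ha s) ?_) (hlam s)
    exact (abs_inner_le_of_le hp (hg s)).trans_eq (by ring)
  have e1 : |inner ℝ p ℓ| ≤ C * (C * (1 + T)) := abs_inner_le_of_le hp hℓ
  have e2 : |inner ℝ p γ| ≤ C * 1 := abs_inner_le_of_le hp hγ.le
  have e3 : |inner ℝ ℓ γ| ≤ C * (1 + T) * 1 := abs_inner_le_of_le hℓ hγ.le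
  have e4 : |inner ℝ p m| ≤ C * (C * (1 + T)) := abs_inner_le_of_le hp hm
  have e5 : |∑ s, lam s * inner ℝ (U s) (g s)| ≤ C * S + C ^ 2 * T := by
    have h1 : C * S + C ^ 2 * T = ∑ s, lam s * ((|mu s| + C) * C) := by
      rw [hT, hS, Finset.mul_sum, Finset.mul_sum, ← Finset.sum_add_distrib]
      exact Finset.sum_congr rfl fun s _ => by ring
    rw [h1]
    refine (Finset.abs_sum_le_sum_abs _ _).trans (Finset.sum_le_sum fun s _ => ?_)
    rw [abs_mul, abs_of_nonneg (hlam s)]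
    refine mul_le_mul_of_nonneg_left (abs_inner_le_of_le ?_ (hg s)) (hlam s)
    rw [hU s]
    refine (norm_add_le _ _).trans (add_le_add ?_ (ha s))
    rw [norm_smul, hq.1 s, mul_one, Real.norm_eq_abs]
  set W := inner ℝ ℓ γ + inner ℝ p m + 2 * ∑ s, lam s * inner ℝ (U s) (g s) with hW
  have e6 : |W| ≤ C * (1 + T) + C * (C * (1 + T)) + 2 * (C * S + C ^ 2 * T) := by
    rw [abs_le] at e3 e4 e5 ⊢
    constructor <;> linarith [e3.1, e3.2, e4.1, e4.2, e5.1, e5.2]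
  have e7 : |inner ℝ p γ * W| ≤
      C * (C * (1 + T) + C * (C * (1 + T)) + 2 * (C * S + C ^ 2 * T)) := by
    rw [abs_mul]
    rw [mul_one] at e2
    exact mul_le_mul e2 e6 (abs_nonneg _) hC
  have e8 := le_of_abs_le e7
  have e9 := neg_le_of_abs_le e1
  have hfin : c₂ * (1 + T) + D * S - (C * (C * (1 + T)) +
      C * (C * (1 + T) + C * (C * (1 + T)) + 2 * (C * S + C ^ 2 * T)) + (c₁ * T + c₁ * S)) =
      2 * C ^ 3 + c₁ := by
    rw [hc₂, hD]
    ring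
  have hC3 : 0 ≤ C ^ 3 := by positivity
  have hexp : S - ((D + 1) * C + 2 * (D + 1) ^ 2 + c₂) * (1 + T) =
      (D + 1) * S - ((D + 1) * C + 2 * (D + 1) ^ 2) * (1 + T) -
        (c₂ * (1 + T) + D * S) := by ring
  rw [hexp]
  linarith only [hmain, hquad, e8, e9, hfin, hC3, hc1T]

lemma sq_norm_tangGrad {γ : E n → E n} {u : E n → ℝ} {y : E n} (hγ : ‖γ y‖ = 1) :
    ‖tangGrad γ u y‖ ^ 2 = inner ℝ (∇ u y) (∇ u y) -
      inner ℝ (inner ℝ (∇ u y) (γ y) : ℝ) (inner ℝ (∇ u y) (γ y) : ℝ) := by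
  rw [tangGrad, norm_sub_sq_real, inner_smul_right, norm_smul, hγ, real_inner_self_eq_norm_sq,
    Real.norm_eq_abs, mul_one, sq_abs]
  simp
  ring

lemma frameOp_sq_norm_tangGrad {q : Fin n → E n} {lam : Fin n → ℝ} {β x : E n} {γ : E n → E n}
    {u : E n → ℝ} (hu : ContDiffAt ℝ 3 u x) (hγ : ContDiffAt ℝ 2 γ x)
    (hγ1 : ∀ᶠ y in 𝓝 x, ‖γ y‖ = 1) :
    ContDiffAt ℝ 2 (fun y => ‖tangGrad γ u y‖ ^ 2) x ∧
    frameOp q lam β (fun y => ‖tangGrad γ u y‖ ^ 2) x =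
      2 * (inner ℝ (∇ u x) (frameOp q lam β (∇ u) x) +
        ∑ s, lam s * ‖fderiv ℝ (∇ u) x (q s)‖ ^ 2 -
        inner ℝ (∇ u x) (γ x) * (inner ℝ (frameOp q lam β (∇ u) x) (γ x) +
          inner ℝ (∇ u x) (frameOp q lam β γ x) +
          2 * ∑ s, lam s * inner ℝ (fderiv ℝ (∇ u) x (q s)) (fderiv ℝ γ x (q s))) -
        ∑ s, lam s * (inner ℝ (fderiv ℝ (∇ u) x (q s)) (γ x) +
          inner ℝ (∇ u x) (fderiv ℝ γ x (q s))) ^ 2) := by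
  have hg : ContDiffAt ℝ 2 (∇ u) x := contDiffAt_gradient hu (by norm_num)
  have hh : ContDiffAt ℝ 2 (fun y => (inner ℝ (∇ u y) (γ y) : ℝ)) x := hg.inner ℝ hγ
  have heq : (fun y => ‖tangGrad γ u y‖ ^ 2) =ᶠ[𝓝 x] fun y => inner ℝ (∇ u y) (∇ u y) +
      (-1 : ℝ) * inner ℝ (inner ℝ (∇ u y) (γ y) : ℝ) (inner ℝ (∇ u y) (γ y) : ℝ) := by
    filter_upwards [hγ1] with y hy
    rw [sq_norm_tangGrad hy]
    ring
  have hc1 : ContDiffAt ℝ 2 (fun y => (inner ℝ (∇ u y) (∇ u y) : ℝ)) x := hg.inner ℝ hg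
  have hc2 : ContDiffAt ℝ 2
      (fun y => (inner ℝ (inner ℝ (∇ u y) (γ y) : ℝ) (inner ℝ (∇ u y) (γ y) : ℝ) : ℝ)) x :=
    hh.inner ℝ hh
  refine ⟨(hc1.add (contDiffAt_const.mul hc2)).congr_of_eventuallyEq heq, ?_⟩
  rw [frameOp_congr heq, frameOp_add hc1 (contDiffAt_const.mul hc2), frameOp_const_mul hc2,
    frameOp_inner hg hg, frameOp_inner hh hh, frameOp_inner hg hγ]
  have hd : ∀ s, fderiv ℝ (fun y => (inner ℝ (∇ u y) (γ y) : ℝ)) x (q s) =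
      inner ℝ (fderiv ℝ (∇ u) x (q s)) (γ x) + inner ℝ (∇ u x) (fderiv ℝ γ x (q s)) := fun s => by
    rw [fderiv_inner_apply ℝ (hg.differentiableAt (by norm_num))
      (hγ.differentiableAt (by norm_num))]
    ring
  simp only [hd, real_inner_self_eq_norm_sq, Real.norm_eq_abs, sq_abs]
  simp only [RCLike.inner_apply, RCLike.conj_to_real,
    real_inner_comm (∇ u x) (frameOp q lam β (∇ u) x)]
  ring

end Tangential

/-! ### The exponential barrier -/

section Barrier

variable {n : ℕ}

lemma app_eq {A : E n → ℝ → E n → SymMat n} {x : E n} {z : ℝ} {p : E n}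
    (hA : ContDiff ℝ 2 (A x z)) (i j k l : Fin n) :
    App A i j k l x z p = mat (fderiv ℝ (fderiv ℝ (A x z)) p (EuclideanSpace.single k 1)
      (EuclideanSpace.single l 1)) i j := by
  have h1 : (fun q => Ap A i j l x z q) =
      fun q => mat (fderiv ℝ (A x z) q (EuclideanSpace.single l 1)) i j := by
    ext q
    exact Ap_eq (hA.contDiffAt.differentiableAt (by norm_num)) i j l
  have h2 : DifferentiableAt ℝ (fun q => fderiv ℝ (A x z) q (EuclideanSpace.single l 1)) p :=
    (contDiffAt_fderiv_apply (m := 1) hA.contDiffAt (by norm_num) _).differentiableAt (by norm_num)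
  rw [App, h1, pd, fderiv_mat_apply h2, fderiv_fderiv_apply hA.contDiffAt]

lemma bil_sum_smul {ι : Type*} (t : Finset ι) (c : ι → ℝ) (r : ι → SymMat n) (ξ ζ : E n) :
    bil (∑ k ∈ t, c k • r k) ξ ζ = ∑ k ∈ t, c k * bil (r k) ξ ζ := by
  have hm : ∀ i j, mat (∑ k ∈ t, c k • r k) i j = ∑ k ∈ t, c k * mat (r k) i j := fun i j => by
    simp [mat, Finset.sum_apply]
  simp only [bil, hm, Finset.mul_sum, Finset.sum_mul]
  rw [Finset.sum_congr rfl fun i _ => Finset.sum_comm, Finset.sum_comm]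
  refine Finset.sum_congr rfl fun s _ => Finset.sum_congr rfl fun i _ =>
    Finset.sum_congr rfl fun j _ => ?_
  ring

lemma Regular.bil_nonneg {Ω : Set (E n)} {A : E n → ℝ → E n → SymMat n} (h : Regular Ω A)
    {x : E n} (hx : x ∈ Ω) {z : ℝ} (hA : ContDiff ℝ 2 (A x z)) (p : E n) {ξ η : E n}
    (hξη : inner ℝ ξ η = 0) : 0 ≤ bil (fderiv ℝ (fderiv ℝ (A x z)) p η η) ξ ξ := by
  have h1 := h x hx z p ξ η hξη
  have h2 : fderiv ℝ (fderiv ℝ (A x z)) p η η = ∑ k, η k • ∑ l, η l •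
      fderiv ℝ (fderiv ℝ (A x z)) p (EuclideanSpace.single k 1) (EuclideanSpace.single l 1) := by
    conv_lhs => rw [clm_eq_sum (fderiv ℝ (fderiv ℝ (A x z)) p) η]
    simp only [sum_apply, smul_apply]
    exact Finset.sum_congr rfl fun k _ => by rw [clm_eq_sum _ η]
  rw [h2]
  simp only [bil_sum_smul]
  convert h1 using 1
  simp only [app_eq hA, bil, Finset.mul_sum]
  rw [Finset.sum_congr rfl fun k _ => Finset.sum_comm, Finset.sum_comm]
  refine Finset.sum_congr rfl fun i _ => ?_
  rw [Finset.sum_congr rfl fun k _ => Finset.sum_comm, Finset.sum_comm]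
  refine Finset.sum_congr rfl fun j _ => Finset.sum_congr rfl fun k _ =>
    Finset.sum_congr rfl fun l _ => ?_
  ring

/-- A quadratic form that is nonnegative on `η^⊥` and of size `O(|η|²)` has negative part
`O(|⟨q, η⟩|)` in the direction `q`: split `q` into its components along and across `η`. -/
lemma bil_ge_of_nonneg_orthogonal {N : SymMat n} {η q : E n} {C R ε : ℝ} (hε : 0 < ε)
    (hN : ‖N‖ ≤ C * ‖η‖ ^ 2) (hη : ‖η‖ ≤ R) (hq : ‖q‖ = 1) (hC : 0 ≤ C)
    (hpos : ∀ ξ : E n, inner ℝ ξ η = 0 → 0 ≤ bil N ξ ξ) :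
    -ε - ((n : ℝ) ^ 2 * C + ((n : ℝ) ^ 2 * C * R) ^ 2 / ε) * inner ℝ q η ^ 2 ≤ bil N q q := by
  set c := (n : ℝ) ^ 2 * C with hc
  have hc0 : 0 ≤ c := by positivity
  have hbil : ∀ ξ ζ : E n, |bil N ξ ζ| ≤ c * ‖η‖ ^ 2 * ‖ξ‖ * ‖ζ‖ := fun ξ ζ => by
    refine (abs_bil_le N ξ ζ).trans ?_
    have : (n : ℝ) ^ 2 * ‖N‖ ≤ c * ‖η‖ ^ 2 := by
      rw [hc, mul_assoc]
      exact mul_le_mul_of_nonneg_left hN (by positivity)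
    gcongr
  set t := inner ℝ q η with ht
  have hR : 0 ≤ R := (norm_nonneg _).trans hη
  have hmain : -(c * t ^ 2) - 2 * (c * R * |t|) ≤ bil N q q := by
    rcases eq_or_ne η 0 with h0 | h0
    · have h1 : |bil N q q| ≤ 0 := by simpa [h0] using hbil q q
      have h2 : t = 0 := by simp [ht, h0]
      have h3 := neg_le_of_abs_le h1
      simp only [h2, abs_zero, mul_zero]
      linarith
    · have hn : 0 < ‖η‖ := norm_pos_iff.2 h0
      set b := t / ‖η‖ ^ 2 with hb
      have hbt : b * ‖η‖ ^ 2 = t := div_mul_cancel₀ _ (by positivity)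
      set ξ := q - b • η with hξ
      have hqe : q = b • η + ξ := by rw [hξ]; abel
      have hξη : inner ℝ ξ η = 0 := by
        rw [hξ, inner_sub_left, inner_smul_left, real_inner_self_eq_norm_sq, ← ht]
        simp [hbt]
      have hξ1 : ‖ξ‖ ≤ 1 := by
        have h1 : ‖q‖ ^ 2 = ‖b • η‖ ^ 2 + ‖ξ‖ ^ 2 := by
          rw [hqe, norm_add_sq_real, inner_smul_left, real_inner_comm, hξη]
          simp
        rw [hq] at h1
        nlinarith [sq_nonneg ‖b • η‖, norm_nonneg ξ]
      have hexp : bil N q q = bil N ξ ξ + 2 * (b * bil N η ξ) + b ^ 2 * bil N η η := by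
        rw [hqe]
        simp only [bil_add_left, bil_add_right, bil_smul_left, bil_smul_right, bil_symm N ξ η]
        ring
      have e1 : |b ^ 2 * bil N η η| ≤ c * t ^ 2 := by
        rw [abs_mul, abs_of_nonneg (sq_nonneg b)]
        calc b ^ 2 * |bil N η η| ≤ b ^ 2 * (c * ‖η‖ ^ 2 * ‖η‖ * ‖η‖) :=
              mul_le_mul_of_nonneg_left (hbil η η) (sq_nonneg b)
          _ = c * (b * ‖η‖ ^ 2) ^ 2 := by ring
          _ = c * t ^ 2 := by rw [hbt]
      have e2 : |b * bil N η ξ| ≤ c * R * |t| := by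
        rw [abs_mul]
        have hbt' : |b| * ‖η‖ ^ 2 = |t| := by
          rw [← hbt, abs_mul, abs_of_nonneg (sq_nonneg ‖η‖)]
        calc |b| * |bil N η ξ| ≤ |b| * (c * ‖η‖ ^ 2 * ‖η‖ * ‖ξ‖) :=
              mul_le_mul_of_nonneg_left (hbil η ξ) (abs_nonneg b)
          _ = c * (‖η‖ * ‖ξ‖) * (|b| * ‖η‖ ^ 2) := by ring
          _ = c * (‖η‖ * ‖ξ‖) * |t| := by rw [hbt']
          _ ≤ c * (R * 1) * |t| := by gcongr
          _ = c * R * |t| := by ring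
      have := hpos ξ hξη
      rw [hexp]
      linarith [neg_le_of_abs_le e1, neg_le_of_abs_le e2]
  -- Young's inequality trades the linear term for `ε`
  have hyoung : 2 * (c * R * |t|) ≤ ε + (c * R) ^ 2 / ε * t ^ 2 := by
    have h1 : ε + (c * R) ^ 2 / ε * t ^ 2 - 2 * (c * R * |t|) = (ε - c * R * |t|) ^ 2 / ε := by
      rw [← sq_abs t]
      field_simp
      ring
    have h2 : 0 ≤ (ε - c * R * |t|) ^ 2 / ε := by positivity
    linarith
  linarith

lemma sub_sub_deriv_ge {g g' g'' : ℝ → ℝ} {κ : ℝ} (h1 : ∀ t, HasDerivAt g (g' t) t)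
    (h2 : ∀ t, HasDerivAt g' (g'' t) t) (hκ : ∀ t ∈ Set.Icc (0 : ℝ) 1, -κ ≤ g'' t) :
    -(κ / 2) ≤ g 1 - g 0 - g' 0 := by
  -- `g + κ t² / 2` is convex on `[0, 1]`
  have hd2 : ∀ t, HasDerivAt (fun t => g' t + κ * t) (g'' t + κ) t := fun t => by
    simpa using (h2 t).fun_add ((hasDerivAt_id' t).const_mul κ)
  have hd1 : ∀ t, HasDerivAt (fun t => g t + κ / 2 * t ^ 2 - g' 0 * t)
      (g' t + κ * t - g' 0) t := fun t => by
    refine (((h1 t).fun_add ((hasDerivAt_pow 2 t).const_mul (κ / 2))).fun_sub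
      ((hasDerivAt_id' t).const_mul (g' 0))).congr_deriv ?_
    norm_num
    ring
  have hm1 : MonotoneOn (fun t => g' t + κ * t) (Set.Icc 0 1) := by
    refine monotoneOn_of_deriv_nonneg (convex_Icc 0 1)
      (fun t _ => (hd2 t).continuousAt.continuousWithinAt)
      (fun t _ => (hd2 t).differentiableAt.differentiableWithinAt) fun t ht => ?_
    rw [(hd2 t).deriv]
    linarith [hκ t (interior_subset ht)]
  have hm2 : MonotoneOn (fun t => g t + κ / 2 * t ^ 2 - g' 0 * t) (Set.Icc 0 1) := by
    refine monotoneOn_of_deriv_nonneg (convex_Icc 0 1)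
      (fun t _ => (hd1 t).continuousAt.continuousWithinAt)
      (fun t _ => (hd1 t).differentiableAt.differentiableWithinAt) fun t ht => ?_
    rw [(hd1 t).deriv]
    have ht' := interior_subset ht
    have := hm1 (Set.left_mem_Icc.2 zero_le_one) ht' ht'.1
    simp only [mul_zero, add_zero] at this
    linarith
  have := hm2 (Set.left_mem_Icc.2 zero_le_one) (Set.right_mem_Icc.2 zero_le_one) zero_le_one
  norm_num at this
  linarith

/-- Regularity of `A` in the form of a one-sided second-order Taylor estimate along a segment. -/
lemma SpectralFrame.form_taylor_ge {L : SymMat n →L[ℝ] ℝ} {G : Matrix (Fin n) (Fin n) ℝ}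
    {w : SymMat n} {q : Fin n → E n} {lam mu : Fin n → ℝ} (hfr : SpectralFrame L G w q lam mu)
    {Ω : Set (E n)} {A : E n → ℝ → E n → SymMat n} (hreg : Regular Ω A) {x : E n} (hx : x ∈ Ω)
    {z : ℝ} (hA : ContDiff ℝ 2 (A x z)) {p η : E n} {C R ε : ℝ} (hε : 0 < ε) (hC : 0 ≤ C)
    (hη : ‖η‖ ≤ R)
    (hbd : ∀ t ∈ Set.Icc (0 : ℝ) 1, ‖fderiv ℝ (fderiv ℝ (A x z)) (p + t • η) η η‖ ≤ C * ‖η‖ ^ 2) :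
    -(ε * ∑ s, lam s +
        ((n : ℝ) ^ 2 * C + ((n : ℝ) ^ 2 * C * R) ^ 2 / ε) * ∑ s, lam s * inner ℝ (q s) η ^ 2) ≤
      L (A x z (p + η)) - L (A x z p) - L (fderiv ℝ (A x z) p η) := by
  obtain ⟨k, hk⟩ : ∃ k, k = (n : ℝ) ^ 2 * C + ((n : ℝ) ^ 2 * C * R) ^ 2 / ε := ⟨_, rfl⟩
  rw [← hk]
  obtain ⟨κ, hκ⟩ : ∃ κ, κ = ε * ∑ s, lam s + k * ∑ s, lam s * inner ℝ (q s) η ^ 2 := ⟨_, rfl⟩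
  rw [← hκ]
  have hk0 : 0 ≤ k := by rw [hk]; positivity
  have hκ0 : 0 ≤ κ := hκ ▸ add_nonneg (mul_nonneg hε.le hfr.sum_nonneg)
    (mul_nonneg hk0 (Finset.sum_nonneg fun s _ => mul_nonneg (hfr.lam_nonneg s) (sq_nonneg _)))
  have hline : ∀ t : ℝ, HasDerivAt (fun t : ℝ => p + t • η) η t := fun t => by
    simpa using ((hasDerivAt_id t).smul_const η).const_add p
  have hd1 : ∀ t : ℝ, HasDerivAt (fun t : ℝ => L (A x z (p + t • η)))
      (L (fderiv ℝ (A x z) (p + t • η) η)) t := fun t => by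
    have hA1 := (hA.differentiable (by norm_num) (p + t • η)).hasFDerivAt
    exact L.hasFDerivAt.comp_hasDerivAt t (hA1.comp_hasDerivAt t (hline t))
  have hd2 : ∀ t : ℝ, HasDerivAt (fun t : ℝ => L (fderiv ℝ (A x z) (p + t • η) η))
      (L (fderiv ℝ (fderiv ℝ (A x z)) (p + t • η) η η)) t := fun t => by
    have hA2 := ((contDiffAt_fderiv_apply (m := 1) (hA.contDiffAt (x := p + t • η))
      (by norm_num) η).differentiableAt (by norm_num)).hasFDerivAt
    refine (L.hasFDerivAt.comp_hasDerivAt t (hA2.comp_hasDerivAt t (hline t))).congr_deriv ?_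
    rw [fderiv_fderiv_apply hA.contDiffAt]
  have := sub_sub_deriv_ge (κ := κ) hd1 hd2 fun t ht => by
    rw [hfr.form_apply, hκ, Finset.mul_sum, Finset.mul_sum, ← Finset.sum_add_distrib,
      ← Finset.sum_neg_distrib]
    refine Finset.sum_le_sum fun s _ => ?_
    have h1 := bil_ge_of_nonneg_orthogonal hε (hbd t ht) hη (hfr.orthonormal.1 s) hC
      fun ξ hξ => hreg.bil_nonneg hx hA (p + t • η) hξ
    have h2 := mul_le_mul_of_nonneg_left h1 (hfr.lam_nonneg s)
    rw [← hk] at h2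
    linarith
  simp only [one_smul, zero_smul, add_zero] at this
  linarith

lemma concaveOn_sub_le {X : Type*} [NormedAddCommGroup X] [NormedSpace ℝ X] {s : Set X}
    {f : X → ℝ} (hf : ConcaveOn ℝ s f) {x y : X} (hx : x ∈ s) (hy : y ∈ s)
    (hd : DifferentiableAt ℝ f x) : f y - f x ≤ fderiv ℝ f x (y - x) := by
  have hline : HasDerivAt (fun t : ℝ => x + t • (y - x)) (y - x) 0 := by
    simpa using ((hasDerivAt_id (0 : ℝ)).smul_const (y - x)).const_add x
  have hd0 : HasFDerivAt f (fderiv ℝ f x) (x + (0 : ℝ) • (y - x)) := by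
    simpa using hd.hasFDerivAt
  have hg : HasDerivAt (fun t : ℝ => f (x + t • (y - x))) (fderiv ℝ f x (y - x)) 0 :=
    hd0.comp_hasDerivAt 0 hline
  have hslope := (hasDerivAt_iff_tendsto_slope_zero.1 hg).mono_left
    (nhdsWithin_mono 0 (fun t (ht : t ∈ Set.Ioi (0 : ℝ)) => ne_of_gt ht))
  refine ge_of_tendsto hslope ?_
  filter_upwards [Ioo_mem_nhdsGT (zero_lt_one' ℝ)] with t ht
  have hconv := hf.2 hx hy (sub_nonneg.2 ht.2.le) ht.1.le (by ring)
  have heq : (1 - t) • x + t • y = x + t • (y - x) := by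
    rw [sub_smul, one_smul, smul_sub]
    abel
  rw [heq] at hconv
  simp only [smul_eq_mul, zero_add, zero_smul, add_zero] at hconv ⊢
  rw [inv_mul_eq_div, le_div_iff₀ ht.1]
  linarith

lemma convexOn_le_sub {X : Type*} [NormedAddCommGroup X] [NormedSpace ℝ X] {s : Set X}
    {f : X → ℝ} (hf : ConvexOn ℝ s f) {x y : X} (hx : x ∈ s) (hy : y ∈ s)
    (hd : DifferentiableAt ℝ f x) : fderiv ℝ f x (y - x) ≤ f y - f x := by
  have := concaveOn_sub_le hf.neg hx hy hd.neg
  rw [fderiv_neg] at this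
  simp only [Pi.neg_apply, neg_apply] at this
  linarith

/-- The identity matrix. -/
def idSym (n : ℕ) : SymMat n := symPart (1 : Matrix (Fin n) (Fin n) ℝ)

lemma bil_idSym (ξ : E n) : bil (idSym n) ξ ξ = ‖ξ‖ ^ 2 := by
  have h : mat (idSym n) = 1 := mat_symPart_of_symm Matrix.transpose_one
  rw [EuclideanSpace.real_norm_sq_eq]
  simp only [bil, h, Matrix.one_apply]
  refine Finset.sum_congr rfl fun i _ => ?_
  simp
  ring

lemma SpectralFrame.form_idSym {L : SymMat n →L[ℝ] ℝ} {G : Matrix (Fin n) (Fin n) ℝ}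
    {w : SymMat n} {q : Fin n → E n} {lam mu : Fin n → ℝ} (hfr : SpectralFrame L G w q lam mu) :
    L (idSym n) = ∑ s, lam s := by
  rw [hfr.form_apply]
  exact Finset.sum_congr rfl fun s _ => by rw [bil_idSym, hfr.orthonormal.1 s]; ring

lemma SpectralFrame.frameOp_eq {L : SymMat n →L[ℝ] ℝ} {G : Matrix (Fin n) (Fin n) ℝ}
    {w : SymMat n} {q : Fin n → E n} {lam mu : Fin n → ℝ} (hfr : SpectralFrame L G w q lam mu)
    {f : E n → ℝ} {x : E n} (hf : ContDiffAt ℝ 2 f x) (β : E n) :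
    frameOp q lam β f x = L (hess f x) - inner ℝ β (∇ f x) := by
  rw [frameOp, hfr.form_apply, inner_gradient_right]
  simp [bil_hess hf]

lemma frameOp_sub {Y : Type*} [NormedAddCommGroup Y] [NormedSpace ℝ Y] {q : Fin n → E n}
    {lam : Fin n → ℝ} {β x : E n} {f g : E n → Y} (hf : ContDiffAt ℝ 2 f x)
    (hg : ContDiffAt ℝ 2 g x) : frameOp q lam β (fun y => f y - g y) x =
      frameOp q lam β f x - frameOp q lam β g x := by
  have h : (fun y => f y - g y) = fun y => f y + (-1 : ℝ) • g y := by
    ext y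
    simp [sub_eq_add_neg]
  rw [h, frameOp_add hf (hg.const_smul (-1 : ℝ)), frameOp_const_smul hg]
  simp [sub_eq_add_neg]

/-- The linearized operator applied to `v - u`, for a strict subsolution `v`. Concavity of `F`,
convexity of `B` and the room `σ I` below `M_u[v]` give the positive terms; regularity of `A` gives
the rest. -/
lemma frameOp_sub_ge {Ω : Set (E n)} {Γ : Set (SymMat n)} {F : SymMat n → ℝ} {a₀ : EReal}
    (hF : BasicConditions Γ F a₀) {A : E n → ℝ → E n → SymMat n} (hreg : Regular Ω A)
    {B : E n → ℝ → E n → ℝ} {x : E n} (hx : x ∈ Ω) {u v : E n → ℝ}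
    (hBc : ConvexOn ℝ Set.univ (B x (u x))) (hBd : DifferentiableAt ℝ (B x (u x)) (∇ u x))
    (hA : ContDiff ℝ 2 (A x (u x))) (hu : ContDiffAt ℝ 2 u x) (hv : ContDiffAt ℝ 2 v x)
    {q : Fin n → E n} {lam mu : Fin n → ℝ}
    (hfr : SpectralFrame (fderiv ℝ F (augHess A u x)) (Fr F (augHess A u x)) (augHess A u x)
      q lam mu)
    (hw : augHess A u x ∈ Γ) (heq : F (augHess A u x) = B x (u x) (∇ u x))
    {δ σ ε C R : ℝ} (hε : 0 < ε) (hC : 0 ≤ C)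
    (hsub : B x (u x) (∇ v x) + δ ≤ F (augHessWrt A u v x))
    (hσ : augHessWrt A u v x - σ • idSym n ∈ Γ)
    (hσF : F (augHessWrt A u v x) - δ / 2 ≤ F (augHessWrt A u v x - σ • idSym n))
    (hR : ‖∇ v x - ∇ u x‖ ≤ R)
    (hbd : ∀ t ∈ Set.Icc (0 : ℝ) 1, ‖fderiv ℝ (fderiv ℝ (A x (u x)))
      (∇ u x + t • (∇ v x - ∇ u x)) (∇ v x - ∇ u x) (∇ v x - ∇ u x)‖ ≤
        C * ‖∇ v x - ∇ u x‖ ^ 2) :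
    δ / 2 + (σ - ε) * ∑ s, lam s - ((n : ℝ) ^ 2 * C + ((n : ℝ) ^ 2 * C * R) ^ 2 / ε) *
        ∑ s, lam s * inner ℝ (q s) (∇ v x - ∇ u x) ^ 2 ≤
      frameOp q lam (drift (fderiv ℝ F (augHess A u x)) (fderiv ℝ (A x (u x)) (∇ u x))
        (fderiv ℝ (B x (u x)) (∇ u x))) (fun y => v y - u y) x := by
  have hFd : DifferentiableAt ℝ F (augHess A u x) :=
    (hF.contDiff.contDiffAt (hF.isOpen.mem_nhds hw)).differentiableAt (by norm_num)
  rw [frameOp_sub hv hu, hfr.frameOp_eq hv, hfr.frameOp_eq hu]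
  have hconc := concaveOn_sub_le hF.F2 hw hσ hFd
  have hconv := convexOn_le_sub hBc (Set.mem_univ (∇ u x)) (Set.mem_univ (∇ v x)) hBd
  have htay := hfr.form_taylor_ge hreg hx hA (p := ∇ u x) hε hC hR hbd
  rw [add_sub_cancel] at htay
  have hdr := inner_drift (fderiv ℝ F (augHess A u x)) (fderiv ℝ (A x (u x)) (∇ u x))
    (fderiv ℝ (B x (u x)) (∇ u x)) (∇ v x - ∇ u x)
  rw [inner_sub_right] at hdr
  have h1 : augHessWrt A u v x - σ • idSym n - augHess A u x =
      (hess v x - hess u x) - (A x (u x) (∇ v x) - A x (u x) (∇ u x)) - σ • idSym n := by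
    simp only [augHess, augHessWrt]
    abel
  rw [h1, map_sub, map_sub, map_sub, map_sub, map_smul, hfr.form_idSym, smul_eq_mul] at hconc
  linarith

/-- If `𝓛 f` is bounded below up to a multiple of `∑ lam_s (D_{q_s} f)²`, exponentiation absorbs
that multiple. -/
lemma frameOp_exp_ge {q : Fin n → E n} {lam : Fin n → ℝ} {β x : E n} {f : E n → ℝ}
    (hf : ContDiffAt ℝ 2 f x) (hlam : ∀ s, 0 ≤ lam s) {K κ c C : ℝ} (hc : 0 ≤ c) (hK : 0 < K)
    (hκ : κ ≤ K) (hC : -C ≤ f x)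
    (h : c * (1 + ∑ s, lam s) - κ * ∑ s, lam s * inner ℝ (q s) (∇ f x) ^ 2 ≤
      frameOp q lam β f x) :
    K * Real.exp (-(K * C)) * c * (1 + ∑ s, lam s) ≤
      frameOp q lam β (fun y => Real.exp (K * f y)) x := by
  have hKf : ContDiffAt ℝ 2 (fun y => K * f y) x := contDiffAt_const.mul hf
  rw [frameOp_exp hKf, frameOp_const_mul hf]
  have hder : ∀ s, fderiv ℝ (fun y => K * f y) x (q s) = K * inner ℝ (q s) (∇ f x) := fun s => by
    rw [fderiv_const_mul (hf.differentiableAt (by norm_num)), inner_gradient_right]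
    simp
  simp only [hder]
  have hsum : ∑ s, lam s * (K * inner ℝ (q s) (∇ f x)) ^ 2 =
      K * (K * ∑ s, lam s * inner ℝ (q s) (∇ f x) ^ 2) := by
    rw [Finset.mul_sum, Finset.mul_sum]
    exact Finset.sum_congr rfl fun s _ => by ring
  rw [hsum, ← mul_add]
  have hS : 0 ≤ ∑ s, lam s * inner ℝ (q s) (∇ f x) ^ 2 :=
    Finset.sum_nonneg fun s _ => mul_nonneg (hlam s) (sq_nonneg _)
  have hT : 0 ≤ ∑ s, lam s := Finset.sum_nonneg fun s _ => hlam s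
  have h1 : c * (1 + ∑ s, lam s) ≤
      frameOp q lam β f x + K * ∑ s, lam s * inner ℝ (q s) (∇ f x) ^ 2 := by
    have := mul_le_mul_of_nonneg_right hκ hS
    linarith
  have h2 : Real.exp (-(K * C)) ≤ Real.exp (K * f x) :=
    Real.exp_le_exp.2 (by nlinarith)
  calc K * Real.exp (-(K * C)) * c * (1 + ∑ s, lam s)
      = Real.exp (-(K * C)) * (K * (c * (1 + ∑ s, lam s))) := by ring
    _ ≤ _ := by gcongr

end Barrier

/-! ### Uniform bounds from compactness -/

section Bounds

variable {n : ℕ}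

lemma CkClosure.contDiffAt {X Y : Type*} [NormedAddCommGroup X] [NormedSpace ℝ X]
    [NormedAddCommGroup Y] [NormedSpace ℝ Y] {U : Set X} {f : X → Y} (h : CkClosure 2 U f)
    (hU : IsOpen U) {x : X} (hx : x ∈ U) : ContDiffAt ℝ 2 f x :=
  h.1.contDiffAt (hU.mem_nhds hx)

lemma CkClosure.exists_bound {X Y : Type*} [NormedAddCommGroup X] [NormedSpace ℝ X]
    [NormedAddCommGroup Y] [NormedSpace ℝ Y] {U K : Set X} {f : X → Y} (h : CkClosure 2 U f)
    (hK : IsCompact K) (hKU : K ⊆ closure U) :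
    ∃ C : ℝ, 0 ≤ C ∧ ∀ x ∈ U, x ∈ K →
      ‖f x‖ ≤ C ∧ ‖fderiv ℝ f x‖ ≤ C ∧ ‖fderiv ℝ (fderiv ℝ f) x‖ ≤ C := by
  obtain ⟨-, h0, hj⟩ := h
  obtain ⟨g1, hg1, he1⟩ := hj 1 (by norm_num)
  obtain ⟨g2, hg2, he2⟩ := hj 2 le_rfl
  obtain ⟨C0, hC0⟩ := hK.exists_bound_of_continuousOn (h0.mono hKU)
  obtain ⟨C1, hC1⟩ := hK.exists_bound_of_continuousOn (hg1.mono hKU)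
  obtain ⟨C2, hC2⟩ := hK.exists_bound_of_continuousOn (hg2.mono hKU)
  refine ⟨|C0| + |C1| + |C2|, by positivity, fun x hx hxK => ?_⟩
  have b0 := abs_nonneg C0
  have b1 := abs_nonneg C1
  have b2 := abs_nonneg C2
  have c0 := (hC0 x hxK).trans (le_abs_self C0)
  have c1 := (hC1 x hxK).trans (le_abs_self C1)
  have c2 := (hC2 x hxK).trans (le_abs_self C2)
  rw [he1 x hx, norm_iteratedFDeriv_one] at c1
  rw [he2 x hx, ← norm_iteratedFDeriv_fderiv, norm_iteratedFDeriv_one] at c2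
  exact ⟨by linarith, by linarith, by linarith⟩

/-! The data `A`, `B` are only evaluated at points `(x, z, p)` of the compact set
`Ω̄ × [-R, R] × B̄_R`. -/

lemma isCompact_jetSet {Ω : Set (E n)} (hΩb : Bornology.IsBounded Ω) (R : ℝ) :
    IsCompact (closure Ω ×ˢ (Set.Icc (-R) R ×ˢ Metric.closedBall (0 : E n) R)) :=
  hΩb.isCompact_closure.prod (isCompact_Icc.prod (isCompact_closedBall 0 R))

lemma jetSet_subset {Ω : Set (E n)} (R : ℝ) :
    closure Ω ×ˢ (Set.Icc (-R) R ×ˢ Metric.closedBall (0 : E n) R) ⊆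
      closure (Ω ×ˢ (Set.univ : Set (ℝ × E n))) := by
  rw [closure_prod_eq, closure_univ]
  exact Set.prod_mono le_rfl (Set.subset_univ _)

lemma exists_jet_bound {Y : Type*} [NormedAddCommGroup Y] [NormedSpace ℝ Y] {Ω : Set (E n)}
    (hΩb : Bornology.IsBounded Ω) {f : E n → ℝ → E n → Y}
    (hf : CkClosure 2 (Ω ×ˢ (Set.univ : Set (ℝ × E n)))
      (fun q : E n × ℝ × E n => f q.1 q.2.1 q.2.2)) (R : ℝ) :
    ∃ C : ℝ, 0 ≤ C ∧ ∀ x ∈ Ω, ∀ z : ℝ, |z| ≤ R → ∀ p : E n, ‖p‖ ≤ R →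
      ‖f x z p‖ ≤ C ∧
      ‖fderiv ℝ (fun q : E n × ℝ × E n => f q.1 q.2.1 q.2.2) (x, z, p)‖ ≤ C ∧
      ‖fderiv ℝ (fderiv ℝ (fun q : E n × ℝ × E n => f q.1 q.2.1 q.2.2)) (x, z, p)‖ ≤ C := by
  obtain ⟨C, hC, h⟩ := hf.exists_bound (isCompact_jetSet hΩb R) (jetSet_subset R)
  refine ⟨C, hC, fun x hx z hz p hp => h (x, z, p) ⟨hx, trivial⟩ ⟨subset_closure hx, ?_, ?_⟩⟩
  · exact abs_le.1 hz
  · simpa using hp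

lemma exists_lower_bound {Ω : Set (E n)} (hΩb : Bornology.IsBounded Ω) (hne : Ω.Nonempty)
    {f : E n → ℝ → E n → ℝ} {a₀ : EReal}
    (hf : CkClosure 2 (Ω ×ˢ (Set.univ : Set (ℝ × E n)))
      (fun q : E n × ℝ × E n => f q.1 q.2.1 q.2.2))
    (hfa : ∀ x ∈ closure Ω, ∀ (z : ℝ) (p : E n), a₀ < (f x z p : EReal)) {R : ℝ} (hR : 0 ≤ R) :
    ∃ b : ℝ, a₀ < (b : EReal) ∧ ∀ x ∈ Ω, ∀ z : ℝ, |z| ≤ R → ∀ p : E n, ‖p‖ ≤ R → b < f x z p := by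
  obtain ⟨x₀, hx₀⟩ := hne
  obtain ⟨m, hm, hmin⟩ := (isCompact_jetSet hΩb R).exists_isMinOn
    ⟨(x₀, 0, 0), subset_closure hx₀, by simpa using hR, by simpa using hR⟩
    (hf.2.1.mono (jetSet_subset R))
  obtain ⟨b, hb1, hb2⟩ := EReal.lt_iff_exists_real_btwn.1 (hfa m.1 hm.1 m.2.1 m.2.2)
  refine ⟨b, hb1, fun x hx z hz p hp => (EReal.coe_lt_coe_iff.1 hb2).trans_le ?_⟩
  exact hmin (a := (x, z, p)) ⟨subset_closure hx, abs_le.1 hz, by simpa using hp⟩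

/-- By F3 the set `{F ≥ b}`, `b > a₀`, is closed in `𝕊ⁿ`. -/
lemma BasicConditions.isClosed_superlevel {Γ : Set (SymMat n)} {F : SymMat n → ℝ} {a₀ : EReal}
    (hF : BasicConditions Γ F a₀) {b : ℝ} (hb : a₀ < (b : EReal)) :
    IsClosed {r | r ∈ Γ ∧ b ≤ F r} := by
  refine isClosed_of_closure_subset fun r hr => ?_
  have hfreq := mem_closure_iff_frequently.1 hr
  have hrΓ : r ∈ Γ := by
    by_contra hn
    have hfront : r ∈ frontier Γ := by
      rw [hF.isOpen.frontier_eq]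
      exact ⟨closure_mono (fun s hs => hs.1) hr, hn⟩
    have hev := eventually_lt_of_limsup_lt ((hF.F3_limsup r hfront).trans_lt hb)
    rw [eventually_nhdsWithin_iff] at hev
    obtain ⟨s, ⟨hsΓ, hsb⟩, hs⟩ := (hfreq.and_eventually hev).exists
    exact absurd (EReal.coe_lt_coe_iff.1 (hs hsΓ)) hsb.not_gt
  refine ⟨hrΓ, ?_⟩
  by_contra! hlt
  have hcont : ContinuousAt F r := (hF.contDiff.contDiffAt (hF.isOpen.mem_nhds hrΓ)).continuousAt
  obtain ⟨s, hs1, hs2⟩ := (hfreq.and_eventually (hcont.eventually_lt_const hlt)).exists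
  exact absurd hs2 hs1.2.not_gt

/-- Bounded matrices with `F ≥ b > a₀` can all be lowered by the same multiple of the identity at
the cost of `η` in the value of `F`. -/
lemma BasicConditions.exists_room {Γ : Set (SymMat n)} {F : SymMat n → ℝ} {a₀ : EReal}
    (hF : BasicConditions Γ F a₀) {b : ℝ} (hb : a₀ < (b : EReal)) (R : ℝ) {η : ℝ} (hη : 0 < η) :
    ∃ σ : ℝ, 0 < σ ∧ ∀ r ∈ Γ, ‖r‖ ≤ R → b ≤ F r →
      r - σ • idSym n ∈ Γ ∧ F r - η ≤ F (r - σ • idSym n) := by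
  have hK : IsCompact ({r | r ∈ Γ ∧ b ≤ F r} ∩ Metric.closedBall 0 R) :=
    (isCompact_closedBall 0 R).inter_left (hF.isClosed_superlevel hb)
  have hev := hK.eventually_forall_of_forall_eventually (x₀ := (0 : ℝ))
    (P := fun σ r => r - σ • idSym n ∈ Γ ∧ F r - η ≤ F (r - σ • idSym n)) fun r hr => by
      have hrΓ : r ∈ Γ := hr.1.1
      have hcont : ContinuousAt F r :=
        (hF.contDiff.contDiffAt (hF.isOpen.mem_nhds hrΓ)).continuousAt
      have hshift : Tendsto (fun z : ℝ × SymMat n => z.2 - z.1 • idSym n) (𝓝 (0, r)) (𝓝 r) := by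
        have : Continuous fun z : ℝ × SymMat n => z.2 - z.1 • idSym n := by fun_prop
        simpa using this.tendsto (0, r)
      have hsnd : Tendsto (fun z : ℝ × SymMat n => z.2) (𝓝 (0, r)) (𝓝 r) :=
        continuous_snd.tendsto (0, r)
      have hdiff : Tendsto (fun z : ℝ × SymMat n => F z.2 - F (z.2 - z.1 • idSym n))
          (𝓝 (0, r)) (𝓝 (F r - F r)) :=
        (hcont.tendsto.comp hsnd).sub (hcont.tendsto.comp hshift)
      rw [sub_self] at hdiff
      filter_upwards [hshift (hF.isOpen.mem_nhds hrΓ), hdiff.eventually_lt_const hη] with z h1 h2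
      exact ⟨h1, by linarith⟩
  have hpos : ∀ᶠ σ : ℝ in 𝓝[>] 0, 0 < σ := self_mem_nhdsWithin
  obtain ⟨σ, hσ, hσ0⟩ := ((hev.filter_mono nhdsWithin_le_nhds).and hpos).exists
  exact ⟨σ, hσ0, fun r hr hrR hrb => hσ r ⟨⟨hr, hrb⟩, by simpa using hrR⟩⟩

lemma norm_gradient_eq (f : E n → ℝ) (x : E n) : ‖∇ f x‖ = ‖fderiv ℝ f x‖ :=
  (InnerProductSpace.toDual ℝ (E n)).symm.norm_map _

lemma norm_symMat_le {r : SymMat n} {C : ℝ} (hC : 0 ≤ C) (h : ∀ i j, |mat r i j| ≤ C) :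
    ‖r‖ ≤ C := by
  change ‖r.1‖ ≤ C
  rw [pi_norm_le_iff_of_nonneg hC]
  intro i
  rw [pi_norm_le_iff_of_nonneg hC]
  exact fun j => h i j

lemma norm_hess_le {f : E n → ℝ} {x : E n} (hf : ContDiffAt ℝ 2 f x) :
    ‖hess f x‖ ≤ ‖fderiv ℝ (fderiv ℝ f) x‖ := by
  refine norm_symMat_le (by positivity) fun i j => ?_
  rw [mat_hess hf, pd_pd_eq hf]
  simpa using (fderiv ℝ (fderiv ℝ f) x).le_opNorm₂ (EuclideanSpace.single i 1)
    (EuclideanSpace.single j 1)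

lemma norm_le_of_inner_le {v : E n} {k : ℝ} (hk : 0 ≤ k) (h : ∀ c, inner ℝ v c ≤ k * ‖c‖) :
    ‖v‖ ≤ k := by
  rcases eq_or_ne v 0 with rfl | hv
  · rwa [norm_zero]
  · have h1 := h v
    rw [real_inner_self_eq_norm_sq, sq] at h1
    exact le_of_mul_le_mul_right h1 (norm_pos_iff.2 hv)

lemma norm_triple_le (v : E n) : ‖((0, 0, v) : E n × ℝ × E n)‖ ≤ ‖v‖ := by
  simp [Prod.norm_def]

lemma norm_fderiv_partial_le {Y : Type*} [NormedAddCommGroup Y] [NormedSpace ℝ Y]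
    {A : E n → ℝ → E n → Y} {x : E n} {z : ℝ} {p : E n}
    (hA : DifferentiableAt ℝ (fun q : E n × ℝ × E n => A q.1 q.2.1 q.2.2) (x, z, p)) {C : ℝ}
    (hC : ‖fderiv ℝ (fun q : E n × ℝ × E n => A q.1 q.2.1 q.2.2) (x, z, p)‖ ≤ C) (v : E n) :
    ‖fderiv ℝ (A x z) p v‖ ≤ C * ‖v‖ := by
  rw [fderiv_partial_apply hA]
  exact ContinuousLinearMap.le_of_opNorm_le_of_le _ hC (norm_triple_le v)

lemma norm_fderiv_fderiv_partial_le {Y : Type*} [NormedAddCommGroup Y] [NormedSpace ℝ Y]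
    {A : E n → ℝ → E n → Y} {x : E n} {z : ℝ}
    (hA : ∀ p, ContDiffAt ℝ 2 (fun q : E n × ℝ × E n => A q.1 q.2.1 q.2.2) (x, z, p)) {C : ℝ}
    {p : E n}
    (hC : ‖fderiv ℝ (fderiv ℝ (fun q : E n × ℝ × E n => A q.1 q.2.1 q.2.2)) (x, z, p)‖ ≤ C)
    (hAp : ContDiffAt ℝ 2 (A x z) p) (v : E n) :
    ‖fderiv ℝ (fderiv ℝ (A x z)) p v v‖ ≤ C * ‖v‖ ^ 2 := by
  rw [← fderiv_fderiv_apply hAp]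
  have h1 : (fun q => fderiv ℝ (A x z) q v) = fun q =>
      fderiv ℝ (fun q : E n × ℝ × E n => A q.1 q.2.1 q.2.2) (x, z, q) (0, 0, v) := by
    ext q
    exact fderiv_partial_apply ((hA q).differentiableAt (by norm_num)) v
  have h2 : DifferentiableAt ℝ (fun q : E n × ℝ × E n =>
      fderiv ℝ (fun q : E n × ℝ × E n => A q.1 q.2.1 q.2.2) q (0, 0, v)) (x, z, p) :=
    (contDiffAt_fderiv_apply (m := 1) (hA p) (by norm_num) _).differentiableAt (by norm_num)
  have h3 := fderiv_partial_apply (A := fun x z p =>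
      fderiv ℝ (fun q : E n × ℝ × E n => A q.1 q.2.1 q.2.2) (x, z, p) (0, 0, v)) h2 v
  have h4 := fderiv_fderiv_apply (hA p) (0, 0, v) (0, 0, v)
  rw [h1]
  refine (congrArg norm (h3.trans h4)).trans_le ?_
  have h5 := (fderiv ℝ (fderiv ℝ (fun q : E n × ℝ × E n => A q.1 q.2.1 q.2.2))
    (x, z, p)).le_opNorm₂ (0, 0, v) (0, 0, v)
  have h6 := norm_triple_le v
  have hC0 : 0 ≤ C := le_trans (by positivity) hC
  calc _ ≤ _ := h5
    _ ≤ C * ‖v‖ * ‖v‖ := by gcongr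
    _ = C * ‖v‖ ^ 2 := by ring

end Bounds

/-! ### The two estimates with uniform constants -/

section Estimates

variable {n : ℕ} {Ω : Set (E n)} {Γ : Set (SymMat n)} {F : SymMat n → ℝ} {a₀ : EReal}
  {A : E n → ℝ → E n → SymMat n} {B : E n → ℝ → E n → ℝ}

lemma C1NormLE.bounds {u : E n → ℝ} {M : ℝ} (h : C1NormLE Ω u M) {x : E n} (hx : x ∈ Ω) :
    |u x| ≤ |M| ∧ ‖∇ u x‖ ≤ |M| := by
  have h1 := (h x hx x hx).trans (le_abs_self M)
  constructor <;> linarith [abs_nonneg (u x), norm_nonneg (∇ u x)]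

lemma contDiffAt_partial {Y : Type*} [NormedAddCommGroup Y] [NormedSpace ℝ Y]
    {f : E n → ℝ → E n → Y} {x : E n} {z : ℝ} {p : E n}
    (h : ContDiffAt ℝ 2 (fun q : E n × ℝ × E n => f q.1 q.2.1 q.2.2) (x, z, p)) :
    ContDiffAt ℝ 2 (f x z) p := by
  have h1 : ContDiffAt ℝ 2 (fun p : E n => (x, z, p)) p :=
    contDiffAt_const.prodMk (contDiffAt_const.prodMk contDiffAt_id)
  exact ContDiffAt.comp (g := fun q : E n × ℝ × E n => f q.1 q.2.1 q.2.2) p h h1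

/-- The barrier estimate `𝓛 e^{K (v - u)} ≥ ε₁ (1 + trace F_r)` with uniform constants. -/
lemma exists_barrier (hΩ : IsOpen Ω) (hΩb : Bornology.IsBounded Ω) (hne : Ω.Nonempty)
    (hF : BasicConditions Γ F a₀)
    (hA : CkClosure 2 (Ω ×ˢ (Set.univ : Set (ℝ × E n)))
      (fun q : E n × ℝ × E n => A q.1 q.2.1 q.2.2))
    (hAreg : Regular Ω A)
    (hB : CkClosure 2 (Ω ×ˢ (Set.univ : Set (ℝ × E n)))
      (fun q : E n × ℝ × E n => B q.1 q.2.1 q.2.2))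
    (hBa : ∀ x ∈ closure Ω, ∀ (z : ℝ) (p : E n), a₀ < (B x z p : EReal))
    (hBconv : ∀ x ∈ Ω, ∀ z : ℝ, ConvexOn ℝ Set.univ (fun p => B x z p))
    {v : E n → ℝ} (hv : CkClosure 2 Ω v) (M : ℝ) {δ : ℝ} (hδ : 0 < δ) :
    ∃ K ε₁ : ℝ, 0 < K ∧ 0 < ε₁ ∧ ∀ u : E n → ℝ, ContDiffOn ℝ 3 u Ω → C1NormLE Ω u M →
      AdmissibleSolution Ω Γ F A B u → StrictSubsolution Ω Γ F A B u v δ →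
      ∀ x ∈ Ω, ∀ (q : Fin n → E n) (lam mu : Fin n → ℝ),
        SpectralFrame (fderiv ℝ F (augHess A u x)) (Fr F (augHess A u x)) (augHess A u x)
          q lam mu →
        ε₁ * (1 + ∑ s, lam s) ≤
          frameOp q lam (drift (fderiv ℝ F (augHess A u x)) (fderiv ℝ (A x (u x)) (∇ u x))
            (fderiv ℝ (B x (u x)) (∇ u x))) (fun y => Real.exp (K * (v y - u y))) x := by
  have hopen : IsOpen (Ω ×ˢ (Set.univ : Set (ℝ × E n))) := hΩ.prod isOpen_univ
  obtain ⟨Cv, hCv, hvb⟩ := hv.exists_bound hΩb.isCompact_closure le_rfl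
  obtain ⟨R, hR⟩ : ∃ R, R = |M| + Cv := ⟨_, rfl⟩
  have hM := abs_nonneg M
  have hR0 : 0 ≤ R := by linarith
  obtain ⟨CA, hCA, hAb⟩ := exists_jet_bound hΩb hA R
  obtain ⟨b, hb, hBb⟩ := exists_lower_bound hΩb hne hB hBa hR0
  obtain ⟨σ, hσ, hroom⟩ := hF.exists_room hb (Cv + CA) (half_pos hδ)
  -- `κ` is the constant of the Taylor estimate with `ε = σ / 2`, which leaves `(σ / 2) T` over
  obtain ⟨κ, hκ⟩ : ∃ κ, κ = (n : ℝ) ^ 2 * CA + ((n : ℝ) ^ 2 * CA * R) ^ 2 / (σ / 2) := ⟨_, rfl⟩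
  have hκ0 : 0 ≤ κ := by rw [hκ]; positivity
  obtain ⟨c, hc⟩ : ∃ c, c = min (δ / 2) (σ / 2) := ⟨_, rfl⟩
  have hc0 : 0 < c := hc ▸ lt_min (half_pos hδ) (half_pos hσ)
  have hcδ : c ≤ δ / 2 := hc ▸ min_le_left _ _
  have hcσ : c ≤ σ / 2 := hc ▸ min_le_right _ _
  refine ⟨κ + 1, (κ + 1) * Real.exp (-((κ + 1) * R)) * c, by positivity, by positivity, ?_⟩
  intro u hu3 hM1 hadm hsub x hx q lam mu hfr
  obtain ⟨hw, heq⟩ := hadm x hx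
  obtain ⟨hvΓ, hvF⟩ := hsub x hx
  obtain ⟨hux, hgux⟩ := hM1.bounds hx
  obtain ⟨hv0, hv1, hv2⟩ := hvb x hx (subset_closure hx)
  rw [← norm_gradient_eq] at hv1
  have hu : ContDiffAt ℝ 2 u x := (hu3.contDiffAt (hΩ.mem_nhds hx)).of_le (by norm_num)
  have hvx : ContDiffAt ℝ 2 v x := hv.contDiffAt hΩ hx
  have hAx : ∀ p, ContDiffAt ℝ 2 (fun q : E n × ℝ × E n => A q.1 q.2.1 q.2.2) (x, u x, p) :=
    fun p => hA.contDiffAt hopen ⟨hx, trivial⟩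
  have hBx : ContDiffAt ℝ 2 (fun q : E n × ℝ × E n => B q.1 q.2.1 q.2.2) (x, u x, ∇ u x) :=
    hB.contDiffAt hopen ⟨hx, trivial⟩
  have hAp : ContDiff ℝ 2 (A x (u x)) := contDiff_iff_contDiffAt.2 fun p =>
    contDiffAt_partial (hAx p)
  have hBd : DifferentiableAt ℝ (B x (u x)) (∇ u x) :=
    (contDiffAt_partial hBx).differentiableAt (by norm_num)
  have huR : |u x| ≤ R := by linarith
  have hgR : ‖∇ u x‖ ≤ R := by linarith
  have hgvR : ‖∇ v x‖ ≤ R := by linarith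
  have hwv : ‖augHessWrt A u v x‖ ≤ Cv + CA :=
    (norm_sub_le _ _).trans
      (add_le_add ((norm_hess_le hvx).trans hv2) (hAb x hx (u x) huR (∇ v x) hgvR).1)
  have hBv := hBb x hx (u x) huR (∇ v x) hgvR
  obtain ⟨hσΓ, hσF⟩ := hroom _ hvΓ hwv (by linarith)
  have hdiff : ‖∇ v x - ∇ u x‖ ≤ R := (norm_sub_le _ _).trans (by linarith)
  have hseg : ∀ t ∈ Set.Icc (0 : ℝ) 1, ‖fderiv ℝ (fderiv ℝ (A x (u x)))
      (∇ u x + t • (∇ v x - ∇ u x)) (∇ v x - ∇ u x) (∇ v x - ∇ u x)‖ ≤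
        CA * ‖∇ v x - ∇ u x‖ ^ 2 := fun t ht => by
    have hp : ‖∇ u x + t • (∇ v x - ∇ u x)‖ ≤ R := by
      have := (convex_closedBall (0 : E n) R).add_smul_sub_mem (x := ∇ u x) (y := ∇ v x)
        (by simpa using hgR) (by simpa using hgvR) ht
      simpa using this
    exact norm_fderiv_fderiv_partial_le hAx (hAb x hx (u x) huR _ hp).2.2 hAp.contDiffAt _
  have hmain := frameOp_sub_ge hF hAreg hx (hBconv x hx (u x)) hBd hAp hu hvx hfr hw heq
    (half_pos hσ) hCA hvF hσΓ hσF hdiff hseg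
  have hgrad : ∇ (fun y => v y - u y) x = ∇ v x - ∇ u x := by
    have := fderiv_fun_sub (hvx.differentiableAt (by norm_num)) (hu.differentiableAt (by norm_num))
    simp only [gradient, this, map_sub]
  have hT := hfr.sum_nonneg
  refine frameOp_exp_ge (hvx.sub hu) hfr.lam_nonneg hc0.le (by positivity)
    (by linarith : κ ≤ κ + 1) ?_ ?_
  · have h1 := neg_le_of_abs_le ((abs_sub (v x) (u x)).trans (add_le_add hv0 hux))
    linarith
  · rw [hgrad]
    rw [← hκ] at hmain
    have h1 : c * (1 + ∑ s, lam s) ≤ δ / 2 + (σ - σ / 2) * ∑ s, lam s := by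
      nlinarith
    linarith

/-- Consequence of the growth condition: `F^{ij} w_{ij} = O(1 + trace F_r)` on solutions. -/
lemma exists_form_self_bound (hg : GrowthCondition Γ F a₀) {b : ℝ} (hb : a₀ < (b : EReal))
    {C : ℝ} (hC : 0 ≤ C) :
    ∃ C' : ℝ, 0 ≤ C' ∧ ∀ w ∈ Γ, b < F w → |F w| ≤ C →
      ∀ (q : Fin n → E n) (lam mu : Fin n → ℝ),
        SpectralFrame (fderiv ℝ F w) (Fr F w) w q lam mu →
        |∑ s, lam s * mu s| ≤ C' * (1 + ∑ s, lam s) := by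
  obtain ⟨Cg, Rg, hg⟩ := hg b hb
  refine ⟨|Cg| * (1 + C) + (n : ℝ) ^ 2 * |Rg|, by positivity, ?_⟩
  intro w hw hbw hFw q lam mu hfr
  have hT := hfr.sum_nonneg
  rw [← hfr.form_self]
  have h1 : 0 ≤ |Cg| * (1 + C) * (1 + ∑ s, lam s) := by positivity
  have h2 : 0 ≤ (n : ℝ) ^ 2 * |Rg| * (1 + ∑ s, lam s) := by positivity
  rw [add_mul]
  -- the growth condition covers large `w`; for bounded `w` the bound is trivial
  by_cases hR : Rg ≤ ‖w‖
  · have h3 := hg w hw hbw hR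
    have h4 : ∑ i, ∑ j, mat w i j * Fr F w i j = fderiv ℝ F w w := by
      rw [← sum_Fr_mul_mat]
      exact Finset.sum_congr rfl fun i _ => Finset.sum_congr rfl fun j _ => mul_comm _ _
    rw [h4, hfr.trace_eq] at h3
    have h5 : Cg * (∑ s, lam s + |F w|) ≤ |Cg| * ((1 + C) * (1 + ∑ s, lam s)) := by
      have h6 : ∑ s, lam s + |F w| ≤ (1 + C) * (1 + ∑ s, lam s) := by nlinarith
      exact mul_le_mul (le_abs_self _) h6 (by positivity) (abs_nonneg _)
    linarith
  · have h3 := hfr.abs_form_le w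
    have h4 : ‖w‖ ≤ |Rg| := (not_le.1 hR).le.trans (le_abs_self _)
    have h5 : (n : ℝ) ^ 2 * ‖w‖ * ∑ s, lam s ≤ (n : ℝ) ^ 2 * |Rg| * (1 + ∑ s, lam s) := by
      gcongr
      linarith
    linarith

/-- The estimate `𝓛 (|δu|² / 2) ≥ ∑ F^{ii} |w_{ii}| - C (1 + trace F_r)` with a uniform
constant. -/
lemma exists_tangential_estimate (hΩ : IsOpen Ω) (hΩb : Bornology.IsBounded Ω) (hne : Ω.Nonempty)
    (hF : BasicConditions Γ F a₀) (hg : GrowthCondition Γ F a₀)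
    (hA : CkClosure 2 (Ω ×ˢ (Set.univ : Set (ℝ × E n)))
      (fun q : E n × ℝ × E n => A q.1 q.2.1 q.2.2))
    (hB : CkClosure 2 (Ω ×ˢ (Set.univ : Set (ℝ × E n)))
      (fun q : E n × ℝ × E n => B q.1 q.2.1 q.2.2))
    (hBa : ∀ x ∈ closure Ω, ∀ (z : ℝ) (p : E n), a₀ < (B x z p : EReal))
    {γ : E n → E n} (hγ : CkClosure 2 Ω γ) (hγ1 : ∀ x ∈ Ω, ‖γ x‖ = 1) (M : ℝ) :
    ∃ C : ℝ, 0 ≤ C ∧ ∀ u : E n → ℝ, ContDiffOn ℝ 3 u Ω → C1NormLE Ω u M →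
      AdmissibleSolution Ω Γ F A B u →
      ∀ x ∈ Ω, ∀ (q : Fin n → E n) (lam mu : Fin n → ℝ),
        SpectralFrame (fderiv ℝ F (augHess A u x)) (Fr F (augHess A u x)) (augHess A u x)
          q lam mu →
        2 * (∑ s, lam s * |mu s| - C * (1 + ∑ s, lam s)) ≤
          frameOp q lam (drift (fderiv ℝ F (augHess A u x)) (fderiv ℝ (A x (u x)) (∇ u x))
            (fderiv ℝ (B x (u x)) (∇ u x))) (fun y => ‖tangGrad γ u y‖ ^ 2) x := by
  have hopen : IsOpen (Ω ×ˢ (Set.univ : Set (ℝ × E n))) := hΩ.prod isOpen_univ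
  have hM := abs_nonneg M
  obtain ⟨Cγ, hCγ, hγb⟩ := hγ.exists_bound hΩb.isCompact_closure le_rfl
  obtain ⟨CA, hCA, hAb⟩ := exists_jet_bound hΩb hA |M|
  obtain ⟨CB, hCB, hBbd⟩ := exists_jet_bound hΩb hB |M|
  obtain ⟨b, hb, hBb⟩ := exists_lower_bound hΩb hne hB hBa hM
  obtain ⟨Cw, hCw, hwb⟩ := exists_form_self_bound hg hb hCB
  obtain ⟨N, hN⟩ : ∃ N, N = (n : ℝ) ^ 2 * CA + CB := ⟨_, rfl⟩
  have hN0 : 0 ≤ N := by rw [hN]; positivity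
  obtain ⟨C, hC⟩ : ∃ C, C = |M| + (n : ℝ) ^ 2 * CA + Cγ + N * (1 + |M|) + Cγ * (1 + N) + Cw :=
    ⟨_, rfl⟩
  have p1 : 0 ≤ (n : ℝ) ^ 2 * CA := by positivity
  have p2 : 0 ≤ N * (1 + |M|) := by positivity
  have p3 : 0 ≤ Cγ * (1 + N) := by positivity
  have hC0 : 0 ≤ C := by linarith
  obtain ⟨C', hC', htan⟩ := tangential_lower_bound (n := n) hC0
  refine ⟨C', hC', ?_⟩
  intro u hu3 hM1 hadm x hx q lam mu hfr
  obtain ⟨hw, heq⟩ := hadm x hx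
  obtain ⟨hux, hgux⟩ := hM1.bounds hx
  obtain ⟨-, hγ2, hγ3⟩ := hγb x hx (subset_closure hx)
  obtain ⟨hA0, hA1, -⟩ := hAb x hx (u x) hux (∇ u x) hgux
  obtain ⟨hB0, hB1, -⟩ := hBbd x hx (u x) hux (∇ u x) hgux
  have hu : ContDiffAt ℝ 3 u x := hu3.contDiffAt (hΩ.mem_nhds hx)
  have hu2 : ContDiffAt ℝ 2 u x := hu.of_le (by norm_num)
  have hγx : ContDiffAt ℝ 2 γ x := hγ.contDiffAt hΩ hx
  have hAd : DifferentiableAt ℝ (fun q : E n × ℝ × E n => A q.1 q.2.1 q.2.2) (x, u x, ∇ u x) :=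
    (hA.contDiffAt hopen ⟨hx, trivial⟩).differentiableAt (by norm_num)
  have hBd : DifferentiableAt ℝ (fun q : E n × ℝ × E n => B q.1 q.2.1 q.2.2) (x, u x, ∇ u x) :=
    (hB.contDiffAt hopen ⟨hx, trivial⟩).differentiableAt (by norm_num)
  have hFd : DifferentiableAt ℝ F (augHess A u x) :=
    (hF.contDiff.contDiffAt (hF.isOpen.mem_nhds hw)).differentiableAt (by norm_num)
  have heqn : ∀ᶠ y in 𝓝 x, F (augHess A u y) = B y (u y) (∇ u y) := by
    filter_upwards [hΩ.mem_nhds hx] with y hy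
    exact (hadm y hy).2
  have hBlow := hBb x hx (u x) hux (∇ u x) hgux
  have hwself := hwb _ hw (by rw [heq]; exact hBlow) (by rw [heq]; exact hB0) q lam mu hfr
  have hT := hfr.sum_nonneg
  have hbound : ∀ c, c ≤ C → c * (1 + ∑ s, lam s) ≤ C * (1 + ∑ s, lam s) := fun c hc =>
    mul_le_mul_of_nonneg_right hc (by linarith)
  -- `dF` is of size `O(trace F_r)`, so expressions `dF(r) + t` are `O(1 + trace F_r)`
  have hform : ∀ (r : SymMat n) (t k : ℝ), 0 ≤ k → ‖r‖ ≤ CA * k → t ≤ CB * k →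
      fderiv ℝ F (augHess A u x) r + t ≤ N * (1 + ∑ s, lam s) * k := fun r t k hk hr ht => by
    have h1 := le_of_abs_le (hfr.abs_form_le r)
    have h2 : (n : ℝ) ^ 2 * ‖r‖ * ∑ s, lam s ≤ (n : ℝ) ^ 2 * (CA * k) * ∑ s, lam s := by
      gcongr
    have h3 : 0 ≤ (n : ℝ) ^ 2 * CA * k := by positivity
    have h4 : 0 ≤ CB * k * ∑ s, lam s := by positivity
    rw [hN]
    linarith
  set β := drift (fderiv ℝ F (augHess A u x)) (fderiv ℝ (A x (u x)) (∇ u x))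
    (fderiv ℝ (B x (u x)) (∇ u x)) with hβ
  have hβn : ‖β‖ ≤ N * (1 + ∑ s, lam s) := by
    refine norm_le_of_inner_le (by positivity) fun c => ?_
    rw [hβ, inner_drift]
    exact hform _ _ _ (norm_nonneg c) (norm_fderiv_partial_le hAd hA1 c)
      ((le_abs_self _).trans (norm_fderiv_partial_le hBd hB1 c))
  have hℓ : ‖frameOp q lam β (∇ u) x‖ ≤ N * (1 + |M|) * (1 + ∑ s, lam s) := by
    refine norm_le_of_inner_le (by positivity) fun c => ?_
    rw [inner_frameOp_gradient hu, frameOp_fderiv_solution hfr hFd hu hAd hBd heqn]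
    have hcn : ‖((c, fderiv ℝ u x c, 0) : E n × ℝ × E n)‖ ≤ (1 + |M|) * ‖c‖ := by
      have h1 : ‖fderiv ℝ u x c‖ ≤ |M| * ‖c‖ :=
        ContinuousLinearMap.le_of_opNorm_le _ (by rwa [← norm_gradient_eq]) c
      have h2 := norm_nonneg c
      have h3 : 0 ≤ |M| * ‖c‖ := by positivity
      simp only [Prod.norm_def, norm_zero, max_le_iff]
      refine ⟨?_, ?_, ?_⟩ <;> linarith
    have h1 := hform _ _ ((1 + |M|) * ‖c‖) (by positivity)
      (ContinuousLinearMap.le_of_opNorm_le_of_le _ hA1 hcn)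
      ((le_abs_self _).trans (ContinuousLinearMap.le_of_opNorm_le_of_le _ hB1 hcn))
    refine h1.trans_eq ?_
    ring
  have hm : ‖frameOp q lam β γ x‖ ≤ Cγ * (1 + N) * (1 + ∑ s, lam s) := by
    have h1 : ‖∑ s, lam s • fderiv ℝ (fderiv ℝ γ) x (q s) (q s)‖ ≤ (∑ s, lam s) * Cγ := by
      rw [Finset.sum_mul]
      refine norm_sum_le_of_le _ fun s _ => ?_
      rw [norm_smul, Real.norm_eq_abs, abs_of_nonneg (hfr.lam_nonneg s)]
      refine mul_le_mul_of_nonneg_left ?_ (hfr.lam_nonneg s)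
      have := (fderiv ℝ (fderiv ℝ γ) x).le_opNorm₂ (q s) (q s)
      rw [hfr.orthonormal.1 s, mul_one, mul_one] at this
      exact this.trans hγ3
    have h2 : ‖fderiv ℝ γ x β‖ ≤ Cγ * (N * (1 + ∑ s, lam s)) :=
      ContinuousLinearMap.le_of_opNorm_le_of_le _ hγ2 hβn
    refine (norm_sub_le _ _).trans ?_
    linarith
  have ha : ∀ s, ‖fderiv ℝ (∇ u) x (q s) - mu s • q s‖ ≤ (n : ℝ) ^ 2 * CA := fun s => by
    refine norm_le_of_inner_le p1 fun c => ?_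
    have h1 : inner ℝ (fderiv ℝ (∇ u) x (q s) - mu s • q s) c =
        bil (A x (u x) (∇ u x)) (q s) c := by
      have h2 : bil (augHess A u x) (q s) c = mu s * inner ℝ (q s) c := by
        rw [bil_symm, PiLp.inner_apply, Finset.mul_sum]
        refine Finset.sum_congr rfl fun i _ => ?_
        have h3 : ∑ j, mat (augHess A u x) i j * c i * q s j =
            c i * ∑ j, mat (augHess A u x) i j * q s j := by
          rw [Finset.mul_sum]
          exact Finset.sum_congr rfl fun j _ => by ring
        rw [h3, hfr.eigen]
        simp
        ring
      rw [inner_sub_left, inner_smul_left, inner_fderiv_gradient hu2, ← bil_hess hu2]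
      simp only [RCLike.conj_to_real]
      rw [← h2, ← bil_sub_mat]
      congr 1
      simp only [augHess, augHessWrt]
      abel
    rw [h1]
    refine (le_of_abs_le (abs_bil_le _ _ _)).trans ?_
    rw [hfr.orthonormal.1 s, mul_one]
    gcongr
  have hgs : ∀ s, ‖fderiv ℝ γ x (q s)‖ ≤ C := fun s => by
    have h1 := ContinuousLinearMap.le_of_opNorm_le_of_le _ hγ2 (hfr.orthonormal.1 s).le
    linarith
  have hγev : ∀ᶠ y in 𝓝 x, ‖γ y‖ = 1 := by
    filter_upwards [hΩ.mem_nhds hx] with y hy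
    exact hγ1 y hy
  rw [(frameOp_sq_norm_tangGrad hu hγx hγev).2]
  refine mul_le_mul_of_nonneg_left ?_ (by norm_num)
  exact htan q (fun s => fderiv ℝ (∇ u) x (q s) - mu s • q s) (fun s => fderiv ℝ γ x (q s))
    (fun s => fderiv ℝ (∇ u) x (q s)) lam mu (γ x) (∇ u x) _ _ hfr.orthonormal hfr.lam_nonneg
    (hγ1 x hx) (by linarith) (fun s => (ha s).trans (by linarith)) hgs
    (hℓ.trans (hbound _ (by linarith))) (hm.trans (hbound _ (by linarith)))
    (hwself.trans (hbound _ (by linarith))) (fun s => by abel)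

end Estimates

end AugHess

end

theorem lemma2p2 {n : ℕ} (Ω : Set (AugHess.E n)) (hΩ : IsOpen Ω) (hΩb : Bornology.IsBounded Ω)
    (Γ : Set (AugHess.SymMat n)) (F : AugHess.SymMat n → ℝ) (a₀ : EReal)
    (hF : AugHess.BasicConditions Γ F a₀)
    (hFinv : AugHess.OrthInvariant Γ F)
    (hFgrowth : AugHess.GrowthCondition Γ F a₀)
    (A : AugHess.E n → ℝ → AugHess.E n → AugHess.SymMat n)
    (hA : AugHess.CkClosure 2 (Ω ×ˢ (Set.univ : Set (ℝ × AugHess.E n)))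
      (fun q : AugHess.E n × ℝ × AugHess.E n => A q.1 q.2.1 q.2.2))
    (hAreg : AugHess.Regular Ω A)
    (B : AugHess.E n → ℝ → AugHess.E n → ℝ)
    (hB : AugHess.CkClosure 2 (Ω ×ˢ (Set.univ : Set (ℝ × AugHess.E n)))
      (fun q : AugHess.E n × ℝ × AugHess.E n => B q.1 q.2.1 q.2.2))
    (hBa : ∀ x ∈ closure Ω, ∀ (z : ℝ) (p : AugHess.E n), a₀ < (B x z p : EReal))
    (hBconv : ∀ x ∈ Ω, ∀ z : ℝ, ConvexOn ℝ Set.univ (fun p => B x z p))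
    (γ : AugHess.E n → AugHess.E n) (hγ : AugHess.CkClosure 2 Ω γ) (hγ1 : ∀ x ∈ Ω, ‖γ x‖ = 1)
    (usub : AugHess.E n → ℝ) (husub : AugHess.CkClosure 2 Ω usub)
    (M δ : ℝ) (hδ : 0 < δ) :
    ∃ K ε₂ : ℝ, 0 < K ∧ 0 < ε₂ ∧
      ∀ u : AugHess.E n → ℝ, AugHess.CkClosure 2 Ω u → ContDiffOn ℝ 3 u Ω →
        AugHess.C1NormLE Ω u M →
        AugHess.AdmissibleSolution Ω Γ F A B u →
        AugHess.StrictSubsolution Ω Γ F A B u usub δ →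
        ∀ x ∈ Ω, ∀ Q ∈ Matrix.orthogonalGroup (Fin n) ℝ,
          (Qᵀ * AugHess.mat (AugHess.augHess A u x) * Q).IsDiag →
          ε₂ * (1 + AugHess.Tstar F (AugHess.augHess A u x) Q) ≤
            AugHess.linOp F A B u
              (fun y => Real.exp (K * (usub y - u y)) +
                ε₂ / 2 * ‖AugHess.tangGrad γ u y‖ ^ 2) x := by
  rcases Ω.eq_empty_or_nonempty with hemp | hne
  · exact ⟨1, 1, one_pos, one_pos, fun u _ _ _ _ _ x hx => by simp [hemp] at hx⟩
  obtain ⟨K, ε₁, hK, hε₁, hbar⟩ :=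
    AugHess.exists_barrier hΩ hΩb hne hF hA hAreg hB hBa hBconv husub M hδ
  obtain ⟨C, hC, htan⟩ :=
    AugHess.exists_tangential_estimate hΩ hΩb hne hF hFgrowth hA hB hBa hγ hγ1 M
  refine ⟨K, ε₁ / (1 + C), hK, by positivity, ?_⟩
  intro u _ hu3 hM hadm hsub x hx Q hQ hdiag
  obtain ⟨q, lam, mu, hfr, hT⟩ := AugHess.exists_spectralFrame hF hFinv (hadm x hx).1 hQ hdiag
  have h1 := hbar u hu3 hM hadm hsub x hx q lam mu hfr
  have h2 := htan u hu3 hM hadm x hx q lam mu hfr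
  have hu : ContDiffAt ℝ 3 u x := hu3.contDiffAt (hΩ.mem_nhds hx)
  have hγev : ∀ᶠ y in 𝓝 x, ‖γ y‖ = 1 := by
    filter_upwards [hΩ.mem_nhds hx] with y hy
    exact hγ1 y hy
  have hexp : ContDiffAt ℝ 2 (fun y => Real.exp (K * (usub y - u y))) x :=
    (contDiffAt_const.mul ((husub.contDiffAt hΩ hx).sub (hu.of_le (by norm_num)))).exp
  have htg : ContDiffAt ℝ 2 (fun y => ‖AugHess.tangGrad γ u y‖ ^ 2) x :=
    (AugHess.frameOp_sq_norm_tangGrad (q := q) (lam := lam) (β := 0) hu (hγ.contDiffAt hΩ hx)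
      hγev).1
  have hAd : DifferentiableAt ℝ (A x (u x)) (∇ u x) :=
    (AugHess.contDiffAt_partial (hA.contDiffAt (hΩ.prod isOpen_univ)
      (show (x, u x, ∇ u x) ∈ Ω ×ˢ Set.univ from ⟨hx, trivial⟩))).differentiableAt (by norm_num)
  rw [AugHess.linOp_eq_frameOp hfr hAd (hexp.add (contDiffAt_const.mul htg)),
    AugHess.frameOp_add hexp (contDiffAt_const.mul htg), AugHess.frameOp_const_mul htg, hT]
  have h3 := mul_le_mul_of_nonneg_left h2 (by positivity : 0 ≤ ε₁ / (1 + C) / 2)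
  have h4 : ∑ s, lam s * (1 + |mu s|) = ∑ s, lam s + ∑ s, lam s * |mu s| := by
    rw [← Finset.sum_add_distrib]
    exact Finset.sum_congr rfl fun s _ => by ring
  have h5 : ε₁ = ε₁ / (1 + C) * (1 + C) := (div_mul_cancel₀ _ (by positivity)).symm
  rw [h4]
  set ε₂ := ε₁ / (1 + C)
  rw [h5] at h1
  linarith
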